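/- Let $B$ be an $m$-dimensional tropical manifold: a smooth manifold with an atlas $\{(U_\lambda,\psi_\lambda)\}$ whose transition functions lie in $\mathbb{R}^m\rtimes GL(\mathbb{Z}^m)$; write $x=(x_1,\dots,x_m)=\psi_\lambda$. Let $K=\{K_\lambda\}$ be a convex multi-valued function on $B$: each $K_\lambda$ is smooth on $U_\lambda$ with positive definite Hessian in the coordinates $x$, and $K_\lambda-K_\mu$ is affine linear in $x$ on $U_\lambda\cap U_\mu$. Put $\tilde x_i=\partial K_\lambda/\partial x_i$. Let $X(B)=TB/\Lambda$ with $\Lambda=\bigoplus_i\mathbb{Z}\,\partial/\partial x_i$, holomorphic coordinates $z_i=x_i+\sqrt{-1}y_i$ ($y_i$ the coefficient of $\partial/\partial x_i$), Kähler form $\omega=\frac{\sqrt{-1}}{2}\sum_{i,j}\frac{\partial^2K_\lambda}{\partial x_i\partial x_j}dz_i\wedge d\bar z_j$ and holomorphic volume form $\Omega=dz_1\wedge\dots\wedge dz_m$. Let $W(B)=T^*B/\Lambda^*$ with $\Lambda^*=\bigoplus_i\mathbb{Z}\,dx_i$, holomorphic coordinates $\tilde z_i=\tilde x_i+\sqrt{-1}\tilde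 y_i$ ($\tilde y_i$ the coefficient of $dx_i$) and Kähler form $\tilde\omega=\sum_i dx_i\wedge d\tilde y_i$. Let $0\le k\le m$. A $k$-dimensional affine subspace of $\mathbb{R}^m$ is rational if it has the form $\mathbb{R}\xi_1+\dots+\mathbb{R}\xi_k+a$, where $\xi_1,\dots,\xi_k$ are part of a basis of $\mathbb{Z}^m$ and $a\in\mathbb{R}^m$. Let $V$ be a constant section of the bundle of $k$-dimensional rational affine subspaces, that is, a family of such subspaces $V_\lambda$, one for each $\lambda$, with $V_\lambda=A(\lambda,\mu)V_\mu+b(\lambda,\mu)$ whenever $U_\lambda\cap U_\mu\ne\emptyset$, where $A(\lambda,\mu)$ is the matrix with entry $\partial x_i^\mu/\partial x_j^\lambda$ in row $j$ and column $i$, and $b(\lambda,\mu)_j=\partial(K_\lambda-K_\mu)/\partial x_j^\lambda$. Let $\overline V_\lambda$ be the linear part of $V_\lambda$ and $\overline V_\lambda^{\perp}=\{w\in\mathbb{R}^m:\sum_i v_iw_i=0\text{ for all }v\in\overline V_\lambda\}$. Put $$B(V)=\bigcup_\lambda\{p\in U_\lambda:\tilde x(p)\in V_\lambda\},$$ and let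 $Y=\sum_jY_j\,\partial/\partial x_j$ be a smooth section of $TB|_{B(V)}$. Define $$L(V,Y)=\Big\{\Big[\sum_i w_i\tfrac{\partial}{\partial x_i}+Y(p)\Big]: p\in B(V)\cap U_\lambda,\ w\in\overline V_\lambda^{\perp}\Big\}\subset X(B),$$ $$C(V)=\Big\{\Big[\sum_i w_i\,dx_i\Big]: p\in B(V)\cap U_\lambda,\ w\in\overline V_\lambda\Big\}\subset W(B),$$ and the Hermitian connection $D^Y=d+\sqrt{-1}\sum_jY_j\,d\tilde y_j$, with curvature $F=d\big(\sqrt{-1}\sum_jY_j\,d\tilde y_j\big)$, on the trivial line bundle $\underline{\mathbb{C}}\to C(V)$. An $m$-dimensional real submanifold $L\subset X(B)$ is Lagrangian if $\omega|_L=0$, and special Lagrangian with phase $e^{\sqrt{-1}\theta}$ if moreover $\operatorname{Im}(e^{-\sqrt{-1}\theta}\Omega)|_L=0$. The connection $D^Y$ is integrable if $F^{(0,2)}=0$, and deformed Hermitian Yang–Mills with phase $e^{\sqrt{-1}\theta}$ if moreover $\operatorname{Im}\big(e^{-\sqrt{-1}\theta}(\tilde\omega+F)^k\big)=0$ on $C(V)$.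 Theorem. $L(V,Y)$ is an $m$-dimensional submanifold of $X(B)$ and $C(V)$ is a complex submanifold of $W(B)$ of complex dimension $k$. $L(V,Y)$ is Lagrangian if and only if $D^Y$ is integrable. Furthermore, for every $\theta\in\mathbb{R}$, $L(V,Y)$ is special Lagrangian with phase $(\sqrt{-1})^{m-k}e^{\sqrt{-1}\theta}$ if and only if $D^Y$ is a deformed Hermitian Yang–Mills connection with phase $e^{\sqrt{-1}\theta}$. In particular, if $m-k$ is even, then $L(V,Y)$ is special Lagrangian with phase $e^{\sqrt{-1}\theta}$ if and only if $D^Y$ is a deformed Hermitian Yang–Mills connection with phase $e^{\sqrt{-1}\theta}$. -/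

import Mathlib

open scoped ContDiff Manifold Matrix

namespace TropicalMirror

noncomputable section

/-! ## Differential geometry in a real normed space -/

/-- `φ : O → E` is a smooth local parametrization of the subset `S` of `E`: an injective immersion of
an open set `O` which is a homeomorphism onto a relatively open subset of `S`. -/
structure IsLocalParam {P E : Type*} [NormedAddCommGroup P] [NormedSpace ℝ P]
    [NormedAddCommGroup E] [NormedSpace ℝ E] (S : Set E) (O : Set P) (φ : P → E) : Prop where
  isOpen : IsOpen O
  smooth : ContDiffOn ℝ ∞ φ O
  mapsTo : Set.MapsTo φ O S
  injOn : Set.InjOn φ O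
  immersion : ∀ u ∈ O, Function.Injective (fderiv ℝ φ u)
  isOpen_image : ∀ O' ⊆ O, IsOpen O' → ∃ U : Set E, IsOpen U ∧ φ '' O' = S ∩ U

/-- `S` is an embedded smooth `d`-dimensional submanifold of `E`. -/
def IsSubmanifold {E : Type*} [NormedAddCommGroup E] [NormedSpace ℝ E] (d : ℕ) (S : Set E) : Prop :=
  ∀ p ∈ S, ∃ (O : Set (Fin d → ℝ)) (φ : (Fin d → ℝ) → E), IsLocalParam S O φ ∧ p ∈ φ '' O

/-- A complex valued real `1`-form, regarded as an alternating form of degree one. -/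
def toForm {P : Type*} [NormedAddCommGroup P] [NormedSpace ℝ P] (α : P →L[ℝ] ℂ) :
    P [⋀^Fin 1]→L[ℝ] ℂ :=
  ContinuousAlternatingMap.ofSubsingleton ℝ P ℂ (0 : Fin 1) α

/-- The curvature `2`-form `F = dα` of the connection `d + α` on the trivial complex line bundle. -/
def curvature {P : Type*} [NormedAddCommGroup P] [NormedSpace ℝ P] (α : P → P →L[ℝ] ℂ) (u : P)
    (a b : P) : ℂ :=
  extDeriv (fun u' => toForm (α u')) u ![a, b]

/-- The `(0,2)`-part of a complex valued `2`-form `β` at a point of `ℂᵏ`: the value of the complex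
bilinear extension of `β` on the `(0,1)`-parts `(a + √-1 J a)/2` and `(b + √-1 J b)/2`. -/
def part02 {k : ℕ} (β : (Fin k → ℂ) → (Fin k → ℂ) → ℂ) (a b : Fin k → ℂ) : ℂ :=
  (1 / 4) * (β a b + Complex.I * β (Complex.I • a) b + Complex.I * β a (Complex.I • b)
    - β (Complex.I • a) (Complex.I • b))

/-- The `k`-fold wedge power `β ∧ ⋯ ∧ β` of a `2`-form `β`, evaluated on `2k` vectors (which are
indexed by `Fin k × Fin 2`). -/
def wedgePow {P : Type*} (k : ℕ) (β : P → P → ℂ) (v : Fin k × Fin 2 → P) : ℂ :=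
  (1 / 2 : ℂ) ^ k * ∑ σ : Equiv.Perm (Fin k × Fin 2),
    ((Equiv.Perm.sign σ : ℤ) : ℂ) * ∏ i : Fin k, β (v (σ (i, 0))) (v (σ (i, 1)))

/-! ## Tropical manifolds -/

/-- The model space `ℝᵐ`. -/
abbrev Rn (m : ℕ) : Type := Fin m → ℝ

/-- A tropical manifold of dimension `m`: a smooth manifold whose given atlas (the tropical
structure) has transition functions in `ℝᵐ ⋊ GL(ℤᵐ)`. -/
class IsTropicalManifold (m : ℕ) (B : Type*) [TopologicalSpace B] [ChartedSpace (Rn m) B] : Prop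
    extends IsManifold 𝓘(ℝ, Rn m) ∞ B where
  transition : ∀ e ∈ atlas (Rn m) B, ∀ e' ∈ atlas (Rn m) B,
    ∃ (A : Matrix.GeneralLinearGroup (Fin m) ℤ) (b : Rn m), ∀ p ∈ e.source ∩ e'.source,
      e' p = ((A : Matrix (Fin m) (Fin m) ℤ).map (Int.cast : ℤ → ℝ)) *ᵥ (e p) + b

section Base

variable (m : ℕ) (B : Type*) [TopologicalSpace B] [ChartedSpace (Rn m) B]

/-- The tropical charts `(U_λ, ψ_λ)`; for `e` of this type, `e.1.source` is `U_λ`, and `e.1` is `ψ_λ`. -/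
abbrev TropChart : Type _ := atlas (Rn m) B

/-- The tangent space `T_p B`. -/
abbrev Tan (p : B) : Type := TangentSpace 𝓘(ℝ, Rn m) p

/-- The cotangent space `T*_p B`. -/
abbrev Cotan (p : B) : Type := Tan m B p →L[ℝ] ℝ

end Base

section Charts

variable {m : ℕ} {B : Type*} [TopologicalSpace B] [ChartedSpace (Rn m) B]

/-- The coordinates of a tangent vector at `p`: the coefficients of the `∂/∂x_i`. -/
def tanCoord (e : TropChart m B) (p : B) : Tan m B p →L[ℝ] Rn m :=
  mfderiv 𝓘(ℝ, Rn m) 𝓘(ℝ, Rn m) e.1 p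

/-- At the point with tropical coordinates `x`, the map `y ↦ ∑ y_i ∂/∂x_i`. -/
def tanVec (e : TropChart m B) (x : Rn m) : Rn m →L[ℝ] Tan m B (e.1.symm x) :=
  mfderiv 𝓘(ℝ, Rn m) 𝓘(ℝ, Rn m) e.1.symm x

/-- The covector `dx_i` at `p`. -/
def dx (e : TropChart m B) (p : B) (i : Fin m) : Cotan m B p :=
  (ContinuousLinearMap.proj (R := ℝ) (φ := fun _ : Fin m => ℝ) i).comp (tanCoord e p)

end Charts

/-! ## The torus bundles `X(B) = TB/Λ` and `W(B) = T*B/Λ*` -/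

section Torus

variable (m : ℕ) (B : Type*) [TopologicalSpace B] [ChartedSpace (Rn m) B]

/-- The lattice `Λ_p ⊆ T_p B` generated by the tropical coordinate vectors `∂/∂x_i`. -/
def lattice (p : B) : Submodule ℤ (Tan m B p) :=
  Submodule.span ℤ {v | ∃ e : TropChart m B, p ∈ e.1.source ∧
    ∃ i : Fin m, tanCoord e p v = Pi.single i 1}

/-- The dual lattice `Λ*_p ⊆ T*_p B` generated by the `dx_i`. -/
def dualLattice (p : B) : Submodule ℤ (Cotan m B p) :=
  Submodule.span ℤ {η | ∃ e : TropChart m B, p ∈ e.1.source ∧ ∃ i : Fin m, η = dx e p i}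

/-- `X(B) = TB/Λ`. -/
abbrev XB : Type _ := Σ p : B, Tan m B p ⧸ lattice m B p

/-- `W(B) = T*B/Λ*`. -/
abbrev WB : Type _ := Σ p : B, Cotan m B p ⧸ dualLattice m B p

end Torus

section Coordinates

variable {m : ℕ} {B : Type*} [TopologicalSpace B] [ChartedSpace (Rn m) B]

/-- The point `[∑ y_i ∂/∂x_i]` of `X(B)` over the point with coordinates `x`. On `ψ_λ(U_λ) × ℝᵐ` this
is a covering map onto the part of `X(B)` over `U_λ`, and its local inverses are the local coordinates
`(x, y)` of `X(B)`. -/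
def xPoint (e : TropChart m B) (z : Rn m × Rn m) : XB m B :=
  ⟨e.1.symm z.1, Submodule.Quotient.mk (tanVec e z.1 z.2)⟩

/-- The point `[∑ y_i dx_i]` of `W(B)` over the point with coordinates `x`. On `ψ_λ(U_λ) × ℝᵐ` this
is a covering map onto the part of `W(B)` over `U_λ`, and its local inverses are the local coordinates
`(x, ỹ)` of `W(B)`. -/
def wPoint (e : TropChart m B) (z : Rn m × Rn m) : WB m B :=
  ⟨e.1.symm z.1, Submodule.Quotient.mk (∑ i, z.2 i • dx e (e.1.symm z.1) i)⟩

/-- A subset of `X(B)` in the coordinates `(x, y)` over `U_λ`. -/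
def xRead (e : TropChart m B) (S : Set (XB m B)) : Set (Rn m × Rn m) :=
  {z | z.1 ∈ e.1.target ∧ xPoint e z ∈ S}

/-- A subset of `W(B)` in the coordinates `(x, ỹ)` over `U_λ`. -/
def wRead (e : TropChart m B) (S : Set (WB m B)) : Set (Rn m × Rn m) :=
  {z | z.1 ∈ e.1.target ∧ wPoint e z ∈ S}

/-- `S` is a real `d`-dimensional submanifold of `X(B)`. -/
def IsSubmanifoldX (d : ℕ) (S : Set (XB m B)) : Prop :=
  ∀ e : TropChart m B, IsSubmanifold d (xRead e S)

end Coordinates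

/-! ## Convex multi-valued functions and the mirror pair -/

/-- A convex multi-valued function `K = {K_λ}` on `B`. -/
structure ConvexMultivalued (m : ℕ) (B : Type*) [TopologicalSpace B] [ChartedSpace (Rn m) B] where
  /-- the functions `K_λ`; only their values on `U_λ` matter -/
  K : TropChart m B → B → ℝ
  smooth : ∀ e, ContDiffOn ℝ ∞ (fun x => K e (e.1.symm x)) e.1.target
  affine : ∀ e e' : TropChart m B, ∃ (a : Rn m) (c : ℝ), ∀ p ∈ e.1.source ∩ e'.1.source,
    K e p - K e' p = a ⬝ᵥ e.1 p + c
  convex : ∀ e : TropChart m B, ∀ x ∈ e.1.target,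
    (Matrix.of fun i j : Fin m => fderiv ℝ
      (fun x' => fderiv ℝ (fun x'' => K e (e.1.symm x'')) x' (Pi.single j 1)) x
      (Pi.single i 1)).PosDef

section Mirror

variable {m : ℕ} {B : Type*} [TopologicalSpace B] [ChartedSpace (Rn m) B]

/-- The Legendre transform `x̃_i = ∂K_λ/∂x_i`, at the point with coordinates `x`. -/
def legendre (K : ConvexMultivalued m B) (e : TropChart m B) (x : Rn m) : Rn m :=
  fun i => fderiv ℝ (fun x' => K.K e (e.1.symm x')) x (Pi.single i 1)

/-- The Hessian `∂²K_λ/∂x_i∂x_j`. -/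
def hess (K : ConvexMultivalued m B) (e : TropChart m B) (x : Rn m) : Matrix (Fin m) (Fin m) ℝ :=
  Matrix.of fun i j => fderiv ℝ (fun x' => legendre K e x' j) x (Pi.single i 1)

/-- The value of `dz_i = dx_i + √-1 dy_i` on a tangent vector of `X(B)`. -/
def dz (v : Rn m × Rn m) (i : Fin m) : ℂ := (v.1 i : ℂ) + Complex.I * (v.2 i : ℂ)

/-- The Kähler form `ω = (√-1/2) ∑ (∂²K_λ/∂x_i∂x_j) dz_i ∧ dz̄_j` on `X(B)`. -/
def omegaX (K : ConvexMultivalued m B) (e : TropChart m B) (z v w : Rn m × Rn m) : ℂ :=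
  (Complex.I / 2) * ∑ i, ∑ j, (hess K e z.1 i j : ℂ) *
    (dz v i * (starRingEnd ℂ) (dz w j) - dz w i * (starRingEnd ℂ) (dz v j))

/-- The holomorphic volume form `Ω = dz_1 ∧ ⋯ ∧ dz_m` on `X(B)`. -/
def OmegaX (v : Fin m → Rn m × Rn m) : ℂ :=
  Matrix.det (Matrix.of fun i j : Fin m => dz (v j) i)

/-- The symplectic (Kähler) form `ω̃ = ∑ dx_i ∧ dỹ_i` on `W(B)`. -/
def omegaW (v w : Rn m × Rn m) : ℝ := ∑ i, (v.1 i * w.2 i - w.1 i * v.2 i)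

/-- The holomorphic coordinates `z̃_i = x̃_i + √-1 ỹ_i` on `W(B)`. -/
def zW (K : ConvexMultivalued m B) (e : TropChart m B) (z : Rn m × Rn m) : Fin m → ℂ :=
  fun i => (legendre K e z.1 i : ℂ) + Complex.I * (z.2 i : ℂ)

/-! ### Lagrangian and special Lagrangian submanifolds of `X(B)` -/

/-- `L` is a Lagrangian submanifold of `(X(B), ω)`. -/
def IsLagrangian (K : ConvexMultivalued m B) (L : Set (XB m B)) : Prop :=
  IsSubmanifoldX m L ∧
  ∀ (e : TropChart m B) (O : Set (Rn m)) (φ : Rn m → Rn m × Rn m), IsLocalParam (xRead e L) O φ →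
    ∀ u ∈ O, ∀ a b : Rn m, omegaX K e (φ u) (fderiv ℝ φ u a) (fderiv ℝ φ u b) = 0

/-- `L` is a special Lagrangian submanifold of `(X(B), ω, Ω)` with phase `e^{√-1 θ}`. -/
def IsSpecialLagrangian (K : ConvexMultivalued m B) (θ : ℝ) (L : Set (XB m B)) : Prop :=
  IsLagrangian K L ∧
  ∀ (e : TropChart m B) (O : Set (Rn m)) (φ : Rn m → Rn m × Rn m), IsLocalParam (xRead e L) O φ →
    ∀ u ∈ O, ∀ a : Fin m → Rn m,
      (Complex.exp (-(Complex.I * (θ : ℂ))) * OmegaX (fun j => fderiv ℝ φ u (a j))).im = 0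

/-! ### Complex submanifolds of `W(B)` and connections over them -/

/-- A holomorphic local parametrization, by an open subset `O` of `ℂᵏ`, of a subset `C` of `W(B)`; it
is written in the coordinates `(x, ỹ)`. -/
def IsHolParam {k : ℕ} (K : ConvexMultivalued m B) (C : Set (WB m B)) (e : TropChart m B)
    (O : Set (Fin k → ℂ)) (φ : (Fin k → ℂ) → Rn m × Rn m) : Prop :=
  IsLocalParam (wRead e C) O φ ∧ DifferentiableOn ℂ (fun u => zW K e (φ u)) O

/-- `C` is a complex submanifold of `W(B)` of complex dimension `k`. -/
def IsComplexSubmanifold (K : ConvexMultivalued m B) (k : ℕ) (C : Set (WB m B)) : Prop :=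
  ∀ e : TropChart m B, ∀ p ∈ wRead e C, ∃ (O : Set (Fin k → ℂ)) (φ : (Fin k → ℂ) → Rn m × Rn m),
    IsHolParam K C e O φ ∧ p ∈ φ '' O

/-- The pull back of a `1`-form `A` (given in the coordinates `(x, ỹ)`) by `φ`. -/
def pullback {k : ℕ} (A : Rn m × Rn m → (Rn m × Rn m →L[ℝ] ℂ)) (φ : (Fin k → ℂ) → Rn m × Rn m)
    (u : Fin k → ℂ) : (Fin k → ℂ) →L[ℝ] ℂ :=
  (A (φ u)).comp (fderiv ℝ φ u)

/-- The connection `D = d + A` on the trivial line bundle over the `k`-dimensional complex submanifold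
`C` of `W(B)` is integrable: the `(0,2)`-part of its curvature vanishes. The `1`-form `A` along `C` is
given, for every tropical chart, in the coordinates `(x, ỹ)`. -/
def IsIntegrable (k : ℕ) (K : ConvexMultivalued m B) (C : Set (WB m B))
    (A : TropChart m B → Rn m × Rn m → (Rn m × Rn m →L[ℝ] ℂ)) : Prop :=
  ∀ (e : TropChart m B) (O : Set (Fin k → ℂ)) (φ : (Fin k → ℂ) → Rn m × Rn m),
    IsHolParam K C e O φ → ∀ u ∈ O, ∀ a b : Fin k → ℂ,
      part02 (curvature (pullback (A e) φ) u) a b = 0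

/-- The connection `D = d + A` on the trivial line bundle over the `k`-dimensional complex submanifold
`C` of `W(B)` with the Kähler form `ω̃|_C` is a deformed Hermitian Yang-Mills connection with phase
`e^{√-1 θ}`: `F^{(0,2)} = 0` and `Im (e^{-√-1 θ} (ω̃ + F)ᵏ) = 0`. -/
def IsDHYM (k : ℕ) (K : ConvexMultivalued m B) (θ : ℝ) (C : Set (WB m B))
    (A : TropChart m B → Rn m × Rn m → (Rn m × Rn m →L[ℝ] ℂ)) : Prop :=
  IsIntegrable k K C A ∧
  ∀ (e : TropChart m B) (O : Set (Fin k → ℂ)) (φ : (Fin k → ℂ) → Rn m × Rn m),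
    IsHolParam K C e O φ → ∀ u ∈ O, ∀ v : Fin k × Fin 2 → (Fin k → ℂ),
      (Complex.exp (-(Complex.I * (θ : ℂ))) * wedgePow k
        (fun a b => (omegaW (fderiv ℝ φ u a) (fderiv ℝ φ u b) : ℂ)
          + curvature (pullback (A e) φ) u a b) v).im = 0

/-! ## The bundle of rational affine subspaces -/

/-- `W` is a `k`-dimensional rational affine subspace of `ℝᵐ` (for `k ≤ m`): `W = ℝξ_1 + ⋯ + ℝξ_k + a`
for the first `k` members of an integral basis `ξ_1, …, ξ_k, ζ_{k+1}, …, ζ_m` of `ℤᵐ`. -/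
def IsRationalAffine (k : ℕ) (W : AffineSubspace ℝ (Rn m)) : Prop :=
  ∃ (ξ : Matrix (Fin m) (Fin m) ℤ) (a : Rn m), (ξ.det = 1 ∨ ξ.det = -1) ∧
    W = AffineSubspace.mk' a
      (Submodule.span ℝ {w | ∃ i : Fin m, (i : ℕ) < k ∧ w = fun j => ((ξ i j : ℤ) : ℝ)})

/-- The matrix `A(λ,μ)`, with `∂x_i^μ/∂x_j^λ` in row `j` and column `i`, at the point `p`. -/
def transA (e e' : TropChart m B) (p : B) : Matrix (Fin m) (Fin m) ℝ :=
  Matrix.of fun j i => fderiv ℝ (fun x => e'.1 (e.1.symm x)) (e.1 p) (Pi.single j 1) i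

/-- The vector `b(λ,μ)` with the components `∂(K_λ - K_μ)/∂x_j^λ`, at the point `p`. -/
def transB (K : ConvexMultivalued m B) (e e' : TropChart m B) (p : B) : Rn m :=
  fun j => fderiv ℝ (fun x => K.K e (e.1.symm x) - K.K e' (e.1.symm x)) (e.1 p) (Pi.single j 1)

/-- A section of the bundle `𝓕(k,m) → B` of `k`-dimensional rational affine subspaces, given by its
local expressions `V_λ : U_λ → F(k,m)`, which are related on overlaps by the transition functions of
the bundle: `V_λ = A(λ,μ) V_μ + b(λ,μ)`. -/
structure AffineSection (K : ConvexMultivalued m B) (k : ℕ) where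
  /-- the local expressions `V_λ`; only their values on `U_λ` matter -/
  loc : TropChart m B → B → AffineSubspace ℝ (Rn m)
  rational : ∀ e : TropChart m B, ∀ p ∈ e.1.source, IsRationalAffine k (loc e p)
  glue : ∀ e e' : TropChart m B, ∀ p ∈ e.1.source ∩ e'.1.source,
    (loc e p : Set (Rn m)) =
      (fun w => transA e e' p *ᵥ w + transB K e e' p) '' (loc e' p : Set (Rn m))

variable {K : ConvexMultivalued m B} {k : ℕ}

/-- The section is constant: every `V_λ` is a constant map. -/
def AffineSection.IsConstant (V : AffineSection K k) : Prop :=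
  ∀ e : TropChart m B, ∃ W : AffineSubspace ℝ (Rn m),
    IsRationalAffine k W ∧ ∀ p ∈ e.1.source, V.loc e p = W

/-- `U_λ(V) = {p ∈ U_λ | μ_λ(p) ∈ V_λ(p)}`, where `μ_λ = (x̃_1, …, x̃_m)`. -/
def AffineSection.localBase (V : AffineSection K k) (e : TropChart m B) : Set B :=
  {p | p ∈ e.1.source ∧ legendre K e (e.1 p) ∈ V.loc e p}

/-- `B(V) = ⋃ U_λ(V)`. -/
def AffineSection.base (V : AffineSection K k) : Set B := ⋃ e : TropChart m B, V.localBase e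

/-- The coefficients of the `∂/∂x_i` of `Y`, as functions of the tropical coordinates `x`. -/
def vecCoord (Y : ∀ p : B, Tan m B p) (e : TropChart m B) (x : Rn m) : Rn m :=
  tanCoord e (e.1.symm x) (Y (e.1.symm x))

/-- `Y` restricts to a smooth section of `ι*(TB)` over `B(V)`: its coefficients in every tropical chart
are smooth on `B(V)`. -/
def IsSmoothAlong (V : AffineSection K k) (Y : ∀ p : B, Tan m B p) : Prop :=
  ∀ e : TropChart m B,
    ContDiffOn ℝ ∞ (vecCoord Y e) {x | x ∈ e.1.target ∧ e.1.symm x ∈ V.base}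

/-! ## `L(V,Y)`, `C(V)` and `D^Y` -/

/-- `L(V,Y) ⊆ X(B)`: the union over `p ∈ B(V)` of the tori `T(V^⊥)_p + Y(p)`, where `T(V^⊥)_p` consists
of the classes of `∑ w_i ∂/∂x_i` with `w` in the annihilator of the linear part of `V_λ(p)`. -/
def lagrangian (V : AffineSection K k) (Y : ∀ p : B, Tan m B p) : Set (XB m B) :=
  {q | ∃ (e : TropChart m B) (x : Rn m) (w : Rn m), x ∈ e.1.target ∧
    e.1.symm x ∈ V.localBase e ∧ (∀ v ∈ (V.loc e (e.1.symm x)).direction, v ⬝ᵥ w = 0) ∧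
    q = ⟨e.1.symm x, Submodule.Quotient.mk (tanVec e x w + Y (e.1.symm x))⟩}

/-- `C(V) ⊆ W(B)`: the union over `p ∈ B(V)` of the tori `T(V)_p`, where `T(V)_p` consists of the
classes of `∑ w_i dx_i` with `w` in the linear part of `V_λ(p)`. -/
def complexSub (V : AffineSection K k) : Set (WB m B) :=
  {q | ∃ (e : TropChart m B) (p : B) (w : Rn m), p ∈ V.localBase e ∧
    w ∈ (V.loc e p).direction ∧ q = ⟨p, Submodule.Quotient.mk (∑ i, w i • dx e p i)⟩}

/-- The connection form `√-1 ∑ Y_j dỹ_j` of the Hermitian connection `D^Y = d + √-1 ∑ Y_j dỹ_j` on the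
trivial line bundle over `C(V)`; only its values over `B(V)` matter. -/
def connForm (Y : ∀ p : B, Tan m B p) (e : TropChart m B) (z : Rn m × Rn m) :
    Rn m × Rn m →L[ℝ] ℂ :=
  ∑ j, (Complex.I * (vecCoord Y e z.1 j : ℂ)) •
    (Complex.ofRealCLM.comp ((ContinuousLinearMap.proj (R := ℝ) (φ := fun _ : Fin m => ℝ) j).comp
      (ContinuousLinearMap.snd ℝ (Rn m) (Rn m))))

end Mirror

end

end TropicalMirror

open TropicalMirror

/-! Everything reduces to two real `k × k` matrices depending only on the point of `B(V)`. In a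
tropical chart, choose an integral basis `ξ` of `ℤᵐ` whose first `k` rows span the linear part of
`V`, with inverse `ζ`, and write `X`, `Z` for their real versions. The functions `F = Zᵀ (x̃ - a)`
are local coordinates on the base, because the Hessian `H` is invertible, and `B(V)` is the locus
where the last `m - k` of them vanish. Because `ξ` is unimodular, dividing by the lattices amounts
to an integrality condition: `L(V,Y)` is the set over `B(V)` where the first `k` components of `X (y
- Y)` are integers, and `C(V)` the one where the last `m - k` components of `Zᵀ ỹ` are. Both are
instances of `fiberedSet`, so `exists_isLocalParam_fiberedSet` gives the submanifold statements and
`IsLocalParam.exists_equiv` gives the tangent spaces for an arbitrary parametrization. On `C(V)` the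
coordinates `z̃` are affine in `u ∈ ℂᵏ`, hence it is complex.

Let `G = X H⁻¹ Xᵀ`, let `N = X Y' H⁻¹ Xᵀ` with `Y'` the derivative of `Y` along `B(V)`, and let
`Gk`, `Nk` be their upper left `k × k` blocks. A tangent vector of `L(V,Y)` is given by `s` in the
first `k` places and `t` in the others, with `X dx = G s` and `X dy = N s + t`. Hence `ω` is the
antisymmetrization of the bilinear form of `Nk`, and `L(V,Y)` is Lagrangian exactly when `Nk` is
symmetric. Up to real factors, `Ω` is the determinant of the matrix with the columns of `G + √-1 N`
in the first `k` places and those of `√-1` times the identity in the rest, which is `(√-1)^(m-k) det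
(Gk + √-1 Nk)`.

A tangent vector of `C(V)` is given by `σ + √-1 τ ∈ ℂᵏ` with `X dx = G σ` and `dỹ = Xᵀ τ`. There `ω̃
+ F` pairs `dσ` with `dτ` through `Gk + √-1 Nk`. Its `(0,2)`-part sees only the antisymmetric part
of `Nk`, and its `k`-th power is a nonzero real multiple of `det (Gk + √-1 Nk)` times the real
volume form. So both sides impose symmetry of `Nk` and `Im (e^{-√-1 θ} det (Gk + √-1 Nk)) = 0` on
`B(V)`, the factor `(√-1)^(m-k)` being the shift of phase. -/

namespace TropicalMirror

/-! ### Local parametrizations and sets fibered over a slice -/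

/-- A smooth map with a differentiable left inverse on a relatively open subset `S'` of `S` is a
local parametrization of `S`. -/
theorem IsLocalParam.of_leftInverse {P E : Type*} [NormedAddCommGroup P] [NormedSpace ℝ P]
    [NormedAddCommGroup E] [NormedSpace ℝ E] {S S' U : Set E} {O : Set P} {φ : P → E} {r : E → P}
    (hO : IsOpen O) (hφ : ContDiffOn ℝ ∞ φ O) (hU : IsOpen U) (hS' : S' = S ∩ U)
    (maps : Set.MapsTo φ O S') (hr : DifferentiableOn ℝ r S')
    (hφr : ∀ p ∈ S', φ (r p) = p) (hrφ : ∀ u ∈ O, r (φ u) = u) : IsLocalParam S O φ where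
  isOpen := hO
  smooth := hφ
  mapsTo u hu := (hS' ▸ maps hu : φ u ∈ S ∩ U).1
  injOn u hu v hv h := by rw [← hrφ u hu, ← hrφ v hv, h]
  immersion u hu := by
    have h1 : HasFDerivAt φ (fderiv ℝ φ u) u :=
      ((hφ.contDiffAt (hO.mem_nhds hu)).differentiableAt (by simp)).hasFDerivAt
    have h2 := (hr (φ u) (maps hu)).hasFDerivWithinAt
    -- Differentiating `r ∘ φ = id` gives a left inverse of the derivative of `φ`. Differentiability
    -- of `r` within `S'` suffices, since `φ` stays in `S'`.
    have h3 := h2.comp_hasFDerivAt u h1 (by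
      filter_upwards [hO.mem_nhds hu] with v hv using maps hv)
    have h4 : HasFDerivAt (r ∘ φ) (ContinuousLinearMap.id ℝ P) u :=
      (hasFDerivAt_id u).congr_of_eventuallyEq (by
        filter_upwards [hO.mem_nhds hu] with v hv using hrφ v hv)
    have h5 := h3.unique h4
    intro a b hab
    have ha := DFunLike.congr_fun h5 a
    have hb := DFunLike.congr_fun h5 b
    simp only [ContinuousLinearMap.comp_apply, ContinuousLinearMap.id_apply] at ha hb
    rw [← ha, ← hb, hab]
  isOpen_image O' hO'O hO' := by
    obtain ⟨U', hU', h⟩ := continuousOn_iff'.1 hr.continuousOn O' hO'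
    refine ⟨U ∩ U', hU.inter hU', ?_⟩
    rw [← Set.inter_assoc, ← hS']
    ext p
    constructor
    · rintro ⟨u, hu, rfl⟩
      refine ⟨maps (hO'O hu), ?_⟩
      have : φ u ∈ r ⁻¹' O' ∩ S' := ⟨by rw [Set.mem_preimage, hrφ u (hO'O hu)]; exact hu, maps (hO'O hu)⟩
      rw [h] at this
      exact this.1
    · rintro ⟨hp, hpU⟩
      have : p ∈ U' ∩ S' := ⟨hpU, hp⟩
      rw [← h] at this
      exact ⟨r p, this.1, hφr p hp⟩

/-- The points of `Ω` at which the components of `F` outside of `p` vanish. -/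
def zeroSlice {m : ℕ} (Ω : Set (Rn m)) (F : Rn m → Rn m) (p : Fin m → Prop) : Set (Rn m) :=
  {x | x ∈ Ω ∧ ∀ i, ¬ p i → F x i = 0}

/-- The set of the `(x, y)`, with `x` in a slice, for which the components in `I` of `y - Y x`
are integral with respect to the linear coordinates `Ξ`. -/
def fiberedSet {m : ℕ} (Ω : Set (Rn m)) (F Y : Rn m → Rn m) (Ξ : Rn m ≃L[ℝ] Rn m)
    (p I : Fin m → Prop) : Set (Rn m × Rn m) :=
  {z | z.1 ∈ zeroSlice Ω F p ∧ ∀ i, I i → ∃ n : ℤ, Ξ (z.2 - Y z.1) i = n}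

/-- The maps `j`, `ρ` identify `P` with the space of the `(s, t)` with `s` supported in `p` and `t`
supported outside of `I`. -/
structure IsCoordModel {m : ℕ} (p I : Fin m → Prop) {P : Type*} [NormedAddCommGroup P]
    [NormedSpace ℝ P] (j : P →L[ℝ] Rn m × Rn m) (ρ : Rn m × Rn m →L[ℝ] P) : Prop where
  left_inv : ∀ u, ρ (j u) = u
  fst_zero : ∀ u i, ¬ p i → (j u).1 i = 0
  snd_zero : ∀ u i, I i → (j u).2 i = 0
  right_inv : ∀ z : Rn m × Rn m, (∀ i, ¬ p i → z.1 i = 0) → (∀ i, I i → z.2 i = 0) → j (ρ z) = z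

section Fibered

variable {m : ℕ} {Ω : Set (Rn m)} {F Y : Rn m → Rn m} {Ξ : Rn m ≃L[ℝ] Rn m} {p I : Fin m → Prop}
  {P : Type*} [NormedAddCommGroup P] [NormedSpace ℝ P]
  {j : P →L[ℝ] Rn m × Rn m} {ρ : Rn m × Rn m →L[ℝ] P}

/-- A map with smooth components and invertible derivative is locally a diffeomorphism. -/
theorem exists_localInverse (hΩ : IsOpen Ω) (hF : ContDiffOn ℝ ∞ F Ω)
    (hF' : ∀ x ∈ Ω, ∃ A : Rn m ≃L[ℝ] Rn m, HasFDerivAt F (A : Rn m →L[ℝ] Rn m) x)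
    {x : Rn m} (hx : x ∈ Ω) :
    ∃ h : OpenPartialHomeomorph (Rn m) (Rn m), x ∈ h.source ∧ h.source ⊆ Ω ∧ (∀ y, h y = F y) ∧
      ContDiffOn ℝ ∞ h.symm h.target := by
  have hFat : ∀ y ∈ Ω, ContDiffAt ℝ ∞ F y := fun y hy => hF.contDiffAt (hΩ.mem_nhds hy)
  obtain ⟨A, hA⟩ := hF' x hx
  let h0 := (hFat x hx).toOpenPartialHomeomorph F hA (by simp)
  refine ⟨h0.restrOpen Ω hΩ, ?_, ?_, fun y => ?_, ?_⟩
  · rw [OpenPartialHomeomorph.restrOpen_source]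
    exact ⟨ContDiffAt.mem_toOpenPartialHomeomorph_source (hFat x hx) hA (by simp), hx⟩
  · rw [OpenPartialHomeomorph.restrOpen_source]
    exact Set.inter_subset_right
  · rfl
  · intro y hy
    have hy' : (h0.restrOpen Ω hΩ).symm y ∈ Ω := by
      have := (h0.restrOpen Ω hΩ).map_target hy
      rw [OpenPartialHomeomorph.restrOpen_source] at this
      exact this.2
    obtain ⟨A', hA'⟩ := hF' _ hy'
    exact ((h0.restrOpen Ω hΩ).contDiffAt_symm hy hA' (hFat _ hy')).contDiffWithinAt

theorem fiberedSet.mapsTo_fst : Set.MapsTo Prod.fst (fiberedSet Ω F Y Ξ p I) (zeroSlice Ω F p) :=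
  fun _ hz => hz.1

/-- Near `z` the integers in the definition cannot jump, so the set is a single sheet there. On it
`F x` and `Ξ (y - Y x)` are coordinates with prescribed zero or constant components, and the
remaining ones form the model space `P`. The explicit values of these coordinates along the
parametrization are kept for the proof that `C(V)` is complex. -/
theorem exists_isLocalParam_fiberedSet (hjρ : IsCoordModel p I j ρ) (hΩ : IsOpen Ω)
    (hF : ContDiffOn ℝ ∞ F Ω)
    (hF' : ∀ x ∈ Ω, ∃ A : Rn m ≃L[ℝ] Rn m, HasFDerivAt F (A : Rn m →L[ℝ] Rn m) x)
    (hY : ContDiffOn ℝ ∞ Y (zeroSlice Ω F p)) {z : Rn m × Rn m} (hz : z ∈ fiberedSet Ω F Y Ξ p I) :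
    ∃ (O : Set P) (φ : P → Rn m × Rn m), IsLocalParam (fiberedSet Ω F Y Ξ p I) O φ ∧ z ∈ φ '' O ∧
      ∃ n : Rn m, ∀ u ∈ O, F (φ u).1 = (j u).1 ∧ Ξ ((φ u).2 - Y (φ u).1) = (j u).2 + n := by
  classical
  obtain ⟨h, hxh, hhΩ, hhF, hh⟩ := exists_localInverse hΩ hF hF' hz.1.1
  choose n0 hn0 using hz.2
  -- The integers attached to `z`, extended by `0` outside of `I`, where the component is free and
  -- is carried by `j`.
  let n : Rn m := fun i => if hi : I i then (n0 i hi : ℝ) else 0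
  have hn : ∀ i (hi : I i), n i = n0 i hi := fun i hi => by simp only [n, hi, dif_pos]
  set S := fiberedSet Ω F Y Ξ p I with hS
  let G : Rn m × Rn m → Rn m := fun w => Ξ (w.2 - Y w.1)
  have hYS : ContDiffOn ℝ ∞ (fun w : Rn m × Rn m => Y w.1) S :=
    hY.comp contDiff_fst.contDiffOn fiberedSet.mapsTo_fst
  have hG : ContDiffOn ℝ ∞ G S := Ξ.contDiff.comp_contDiffOn (contDiff_snd.contDiffOn.sub hYS)
  let O : Set P := {u | (j u).1 ∈ h.target}
  let g : P → Rn m := fun u => h.symm (j u).1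
  let φ : P → Rn m × Rn m := fun u => (g u, Y (g u) + Ξ.symm ((j u).2 + n))
  let S' : Set (Rn m × Rn m) := {w | w ∈ S ∧ w.1 ∈ h.source ∧ ∀ i, I i → G w i = n i}
  let r : Rn m × Rn m → P := fun w => ρ (F w.1, G w - n)
  have hj1 : ContDiff ℝ ∞ (fun u => (j u).1) := contDiff_fst.comp j.contDiff
  have hj2 : ContDiff ℝ ∞ (fun u => (j u).2) := contDiff_snd.comp j.contDiff
  have hO : IsOpen O := h.open_target.preimage hj1.continuous
  have hFg : ∀ u ∈ O, F (g u) = (j u).1 := fun u hu => by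
    rw [← hhF]; exact h.right_inv hu
  have hgmem : ∀ u ∈ O, g u ∈ zeroSlice Ω F p := fun u hu =>
    ⟨hhΩ (h.map_target hu), fun i hi => by rw [hFg u hu]; exact hjρ.fst_zero u i hi⟩
  have hg : ContDiffOn ℝ ∞ g O := hh.comp hj1.contDiffOn fun u hu => hu
  have hGφ : ∀ u, G (φ u) = (j u).2 + n := fun u => by simp [G, φ]
  have hφ : ContDiffOn ℝ ∞ φ O :=
    hg.prodMk ((hY.comp hg hgmem).add
      (Ξ.symm.contDiff.comp (hj2.add contDiff_const)).contDiffOn)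
  have hGI : ∀ u i, I i → G (φ u) i = n i := fun u i hi => by
    rw [hGφ, Pi.add_apply, hjρ.snd_zero u i hi, zero_add]
  have maps : Set.MapsTo φ O S' := fun u hu =>
    ⟨⟨hgmem u hu, fun i hi => ⟨n0 i hi, by rw [← hn i hi]; exact hGI u i hi⟩⟩,
      h.map_target hu, hGI u⟩
  have hrj : ∀ w ∈ S', j (r w) = (F w.1, G w - n) := fun w hw =>
    hjρ.right_inv _ (fun i hi => hw.1.1.2 i hi) fun i hi => by
      simp [hw.2.2 i hi]
  have hrO : Set.MapsTo r S' O := fun w hw => by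
    change (j (r w)).1 ∈ h.target
    rw [hrj w hw, ← hhF]
    exact h.map_source hw.2.1
  have hzS' : z ∈ S' := ⟨hz, hxh, fun i hi => (hn0 i hi).trans (hn i hi).symm⟩
  have hφr : ∀ w ∈ S', φ (r w) = w := fun w hw => by
    have h1 : g (r w) = w.1 := by
      change h.symm (j (r w)).1 = w.1
      rw [hrj w hw, ← hhF]
      exact h.left_inv hw.2.1
    refine Prod.ext h1 ?_
    change Y (g (r w)) + Ξ.symm ((j (r w)).2 + n) = w.2
    rw [h1, hrj w hw]
    simp [G]
  have hrφ : ∀ u ∈ O, r (φ u) = u := fun u hu => by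
    change ρ (F (g u), G (φ u) - n) = u
    rw [hFg u hu, hGφ, add_sub_cancel_right]
    exact hjρ.left_inv u
  -- The sheet `S'` is relatively open: an integer at distance less than `1` from `n i` equals `n
  -- i`, so the closed condition in `S'` can be replaced by an open one.
  obtain ⟨U1, hU1, hU1'⟩ := continuousOn_iff'.1 hG.continuousOn
    (⋂ i ∈ Set.univ, {w : Rn m | I i → |w i - n i| < 1}) (by
      refine Set.finite_univ.isOpen_biInter fun i _ => ?_
      by_cases hi : I i
      · simp only [hi, true_imp_iff]
        exact isOpen_lt (by fun_prop) continuous_const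
      · simp [hi])
  have hS' : S' = S ∩ (Prod.fst ⁻¹' h.source ∩ U1) := by
    ext w
    have key : w ∈ S → (w ∈ U1 ↔ ∀ i, I i → G w i = n i) := fun hw => by
      have h1 : w ∈ U1 ↔ w ∈ U1 ∩ S := by simp [hw]
      rw [h1, ← hU1']
      simp only [Set.mem_inter_iff, hw, and_true, Set.mem_preimage, Set.mem_iInter, Set.mem_univ,
        true_imp_iff, Set.mem_ofPred_eq]
      refine forall₂_congr fun i hi => ⟨fun hlt => ?_, fun he => by simp [he]⟩
      obtain ⟨a, ha⟩ := hw.2 i hi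
      change G w i = a at ha
      rw [ha, hn i hi] at hlt ⊢
      have : |a - n0 i hi| < 1 := by exact_mod_cast hlt
      rw [Int.abs_lt_one_iff] at this
      rw [sub_eq_zero.1 this]
    constructor
    · rintro ⟨hw, h1, h2⟩
      exact ⟨hw, h1, (key hw).2 h2⟩
    · rintro ⟨hw, h1, h2⟩
      exact ⟨hw, h1, (key hw).1 h2⟩
  have hr : DifferentiableOn ℝ r S' := by
    have hSS : S' ⊆ S := fun w hw => hw.1
    have hFS : ContDiffOn ℝ ∞ (fun w : Rn m × Rn m => F w.1) S' :=
      hF.comp contDiff_fst.contDiffOn fun w hw => hw.1.1.1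
    exact (ρ.contDiff.comp_contDiffOn
      (hFS.prodMk ((hG.mono hSS).sub contDiffOn_const))).differentiableOn (by simp)
  exact ⟨O, φ, .of_leftInverse hO hφ ((h.open_source.preimage continuous_fst).inter hU1) hS' maps
    hr hφr hrφ, ⟨r z, hrO hzS', hφr z hzS'⟩, n, fun u hu => ⟨hFg u hu, hGφ u⟩⟩

/-- In the coordinates given by `F` and `Ξ`, the derivative of every local parametrization of a
fibered set is an automorphism of the model of its tangent space. -/
theorem IsLocalParam.exists_equiv [FiniteDimensional ℝ P] (hjρ : IsCoordModel p I j ρ)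
    {O : Set P} {φ : P → Rn m × Rn m} (hφ : IsLocalParam (fiberedSet Ω F Y Ξ p I) O φ)
    (hY : ContDiffOn ℝ ∞ Y (zeroSlice Ω F p)) {u : P} (hu : u ∈ O) {F' : Rn m ≃L[ℝ] Rn m}
    (hF' : HasFDerivAt F (F' : Rn m →L[ℝ] Rn m) (φ u).1) :
    ∃ M : P ≃ₗ[ℝ] P, ∀ v, F' (fderiv ℝ φ u v).1 = (j (M v)).1 ∧
      Ξ ((fderiv ℝ φ u v).2 - fderivWithin ℝ Y (zeroSlice Ω F p) (φ u).1 (fderiv ℝ φ u v).1)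
        = (j (M v)).2 := by
  set Y' := fderivWithin ℝ Y (zeroSlice Ω F p) (φ u).1
  set φ' := fderiv ℝ φ u
  have hOu := hφ.isOpen.mem_nhds hu
  have h1 : HasFDerivAt φ φ' u :=
    ((hφ.smooth.contDiffAt hOu).differentiableAt (by simp)).hasFDerivAt
  have h11 : HasFDerivAt (fun v => (φ v).1) ((ContinuousLinearMap.fst ℝ _ _).comp φ') u := h1.fst
  have h12 : HasFDerivAt (fun v => (φ v).2) ((ContinuousLinearMap.snd ℝ _ _).comp φ') u := h1.snd
  -- `Y` is controlled only on the slice, so its derivative is taken within the slice. The chain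
  -- rule applies because the first component of `φ` stays there.
  have hYφ : HasFDerivAt (fun v => Y (φ v).1) (Y'.comp ((ContinuousLinearMap.fst ℝ _ _).comp φ')) u :=
    (((hY _ (hφ.mapsTo hu).1).differentiableWithinAt (by simp)).hasFDerivWithinAt).comp_hasFDerivAt
      u h11 (by filter_upwards [hOu] with v hv using (hφ.mapsTo hv).1)
  have hFφ : HasFDerivAt (fun v => F (φ v).1) ((F' : Rn m →L[ℝ] Rn m).comp
    ((ContinuousLinearMap.fst ℝ _ _).comp φ')) u := hF'.comp u h11
  have hGφ : HasFDerivAt (fun v => Ξ ((φ v).2 - Y (φ v).1)) ((Ξ : Rn m →L[ℝ] Rn m).comp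
    ((ContinuousLinearMap.snd ℝ _ _).comp φ' - Y'.comp ((ContinuousLinearMap.fst ℝ _ _).comp φ'))) u :=
    Ξ.hasFDerivAt.comp u (h12.sub hYφ)
  have hs : ∀ v i, ¬ p i → F' (φ' v).1 i = 0 := fun v i hi => by
    have h2 := (hasFDerivAt_pi'.1 hFφ i)
    have h3 : HasFDerivAt (fun v => F (φ v).1 i) (0 : P →L[ℝ] ℝ) u :=
      (hasFDerivAt_const (0 : ℝ) u).congr_of_eventuallyEq (by
        filter_upwards [hOu] with v hv using (hφ.mapsTo hv).1.2 i hi)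
    exact DFunLike.congr_fun (h2.unique h3) v
  -- A continuous function with integral values is locally constant, so its derivative vanishes.
  have ht : ∀ v i, I i → Ξ ((φ' v).2 - Y' (φ' v).1) i = 0 := fun v i hi => by
    have h2 := (hasFDerivAt_pi'.1 hGφ i)
    have h3 : HasFDerivAt (fun v => Ξ ((φ v).2 - Y (φ v).1) i) (0 : P →L[ℝ] ℝ) u := by
      refine (hasFDerivAt_const (Ξ ((φ u).2 - Y (φ u).1) i) u).congr_of_eventuallyEq ?_
      have hc : ContinuousAt (fun v => Ξ ((φ v).2 - Y (φ v).1) i) u := h2.continuousAt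
      filter_upwards [hOu, hc.eventually (Metric.ball_mem_nhds _ one_pos)] with v hv hlt
      obtain ⟨a, ha⟩ := (hφ.mapsTo hv).2 i hi
      obtain ⟨b, hb⟩ := (hφ.mapsTo hu).2 i hi
      rw [ha, hb, Real.dist_eq] at hlt
      have : |a - b| < 1 := by exact_mod_cast hlt
      rw [Int.abs_lt_one_iff] at this
      rw [ha, hb, sub_eq_zero.1 this]
    exact DFunLike.congr_fun (h2.unique h3) v
  let L : P →ₗ[ℝ] Rn m × Rn m :=
    { toFun := fun v => (F' (φ' v).1, Ξ ((φ' v).2 - Y' (φ' v).1))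
      map_add' := fun v w => by
        simp only [map_add, Prod.fst_add, Prod.snd_add, map_sub, Prod.mk_add_mk]
        congr 1; abel
      map_smul' := fun c v => by
        simp only [map_smul, Prod.smul_fst, Prod.smul_snd, map_sub, Prod.smul_mk, RingHom.id_apply,
          smul_sub] }
  have hL : ∀ v, j (ρ (L v)) = L v := fun v => hjρ.right_inv _ (hs v) (ht v)
  -- The base component is recovered through `F'`, then the fiber component through `Ξ`. An
  -- injective endomorphism of the finite dimensional `P` is an automorphism.
  have hinj : Function.Injective ((ρ : Rn m × Rn m →ₗ[ℝ] P).comp L) := by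
    intro v w hvw
    have h2 : L v = L w := by
      rw [← hL v, ← hL w]
      exact congrArg j hvw
    have h3 : (φ' v).1 = (φ' w).1 := F'.injective (congrArg Prod.fst h2)
    have h4 := Ξ.injective (congrArg Prod.snd h2)
    rw [h3, sub_left_inj] at h4
    exact hφ.immersion u hu (Prod.ext h3 h4)
  refine ⟨LinearEquiv.ofInjectiveEndo _ hinj, fun v => ?_⟩
  have : j (LinearEquiv.ofInjectiveEndo _ hinj v) = L v := hL v
  rw [this]
  exact ⟨rfl, rfl⟩

end Fibered

/-! ### The top power of a two-form as a determinant -/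

section WedgePow

/-- The form `∑ Z_ij dp_i ∧ dq_j` on the space of the `(p, q)`, where `p i = u (i, 0)` and
`q j = u (j, 1)`. -/
def pairForm {ι : Type*} [Fintype ι] (Z : Matrix ι ι ℂ) (u w : ι × Fin 2 → ℂ) : ℂ :=
  ∑ i, ∑ j, Z i j * (u (i, 0) * w (j, 1) - w (i, 0) * u (j, 1))

/-- `pairForm` as a bilinear map. -/
def pairFormLin {ι : Type*} [Fintype ι] (Z : Matrix ι ι ℂ) :
    (ι × Fin 2 → ℂ) →ₗ[ℂ] (ι × Fin 2 → ℂ) →ₗ[ℂ] ℂ :=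
  LinearMap.mk₂ ℂ (pairForm Z)
    (fun u u' w => by
      simp only [pairForm, Pi.add_apply, ← Finset.sum_add_distrib]
      exact Finset.sum_congr rfl fun i _ => Finset.sum_congr rfl fun j _ => by ring)
    (fun c u w => by
      simp only [pairForm, Pi.smul_apply, smul_eq_mul, Finset.mul_sum]
      exact Finset.sum_congr rfl fun i _ => Finset.sum_congr rfl fun j _ => by ring)
    (fun u w w' => by
      simp only [pairForm, Pi.add_apply, ← Finset.sum_add_distrib]
      exact Finset.sum_congr rfl fun i _ => Finset.sum_congr rfl fun j _ => by ring)
    (fun c u w => by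
      simp only [pairForm, Pi.smul_apply, smul_eq_mul, Finset.mul_sum]
      exact Finset.sum_congr rfl fun i _ => Finset.sum_congr rfl fun j _ => by ring)

/-- The multilinear map `v ↦ ∏ β (v (i, 0)) (v (i, 1))`. -/
def prodPairs {k : ℕ} {E : Type*} [AddCommGroup E] [Module ℂ E] (β : E →ₗ[ℂ] E →ₗ[ℂ] ℂ) :
    MultilinearMap ℂ (fun _ : Fin k × Fin 2 => E) ℂ :=
  MultilinearMap.mk' (fun v => ∏ i, β (v (i, 0)) (v (i, 1)))
    (fun v s x y => by
      obtain ⟨i, c⟩ := s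
      have h : ∀ z : E, ∏ l, β (Function.update v (i, c) z (l, 0)) (Function.update v (i, c) z (l, 1))
          = β (Function.update v (i, c) z (i, 0)) (Function.update v (i, c) z (i, 1)) *
            ∏ l ∈ Finset.univ.erase i, β (v (l, 0)) (v (l, 1)) := fun z => by
        rw [← Finset.mul_prod_erase _ _ (Finset.mem_univ i)]
        congr 1
        refine Finset.prod_congr rfl fun l hl => ?_
        have hli : l ≠ i := (Finset.mem_erase.1 hl).1
        rw [Function.update_of_ne (by simp [hli]), Function.update_of_ne (by simp [hli])]
      rw [h, h, h, ← add_mul]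
      fin_cases c <;> simp [Function.update])
    (fun v s a x => by
      obtain ⟨i, c⟩ := s
      have h : ∀ z : E, ∏ l, β (Function.update v (i, c) z (l, 0)) (Function.update v (i, c) z (l, 1))
          = β (Function.update v (i, c) z (i, 0)) (Function.update v (i, c) z (i, 1)) *
            ∏ l ∈ Finset.univ.erase i, β (v (l, 0)) (v (l, 1)) := fun z => by
        rw [← Finset.mul_prod_erase _ _ (Finset.mem_univ i)]
        congr 1
        refine Finset.prod_congr rfl fun l hl => ?_
        have hli : l ≠ i := (Finset.mem_erase.1 hl).1
        rw [Function.update_of_ne (by simp [hli]), Function.update_of_ne (by simp [hli])]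
      rw [h, h, smul_eq_mul, ← mul_assoc]
      fin_cases c <;> simp [Function.update])

theorem wedgePow_eq_alternatization {k : ℕ} {E : Type*} [AddCommGroup E] [Module ℂ E]
    (β : E →ₗ[ℂ] E →ₗ[ℂ] ℂ) (v : Fin k × Fin 2 → E) :
    wedgePow k (fun a b => β a b) v =
      (1 / 2 : ℂ) ^ k * MultilinearMap.alternatization (prodPairs (k := k) β) v := by
  rw [wedgePow, MultilinearMap.alternatization_apply]
  congr 1
  refine Finset.sum_congr rfl fun σ _ => ?_
  rw [Units.smul_def, zsmul_eq_mul]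
  rfl

/-- The value of the standard symplectic form on two members of the standard basis. -/
def stdPairing {k : ℕ} (s t : Fin k × Fin 2) : ℤ :=
  if s.1 = t.1 then (if s.2 = 0 ∧ t.2 = 1 then 1 else if s.2 = 1 ∧ t.2 = 0 then -1 else 0) else 0

theorem pairForm_one_single {k : ℕ} (s t : Fin k × Fin 2) :
    pairForm (1 : Matrix (Fin k) (Fin k) ℂ) (Pi.single s 1) (Pi.single t 1) = stdPairing s t := by
  obtain ⟨i, c⟩ := s
  obtain ⟨j, d⟩ := t
  simp only [pairForm, Matrix.one_apply, ite_mul, one_mul, zero_mul, Finset.sum_ite_eq,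
    Finset.mem_univ, if_true, Pi.single_apply, Prod.mk.injEq, stdPairing]
  fin_cases c <;> fin_cases d <;> simp [← ite_and]
  · by_cases h : i = j
    · simp [h, Finset.filter_eq']
    · simp only [h, if_false, Nat.cast_eq_zero, Finset.card_eq_zero, Finset.filter_eq_empty_iff]
      rintro x - ⟨rfl, rfl⟩
      exact h rfl
  · by_cases h : i = j
    · simp [h, Finset.filter_eq']
    · simp only [h, if_false, neg_eq_zero, Nat.cast_eq_zero, Finset.card_eq_zero,
        Finset.filter_eq_empty_iff]
      rintro x - ⟨rfl, rfl⟩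
      exact h rfl

/-- A nonzero term comes from a permutation that maps each pair `(i, 0), (i, 1)` onto such a pair.
Permuting whole pairs is even, and each swap inside a pair contributes `-1` both to the sign and to
the product. Thus no cancellation occurs in the power of the standard symplectic form. -/
theorem sign_mul_prod_stdPairing_nonneg {k : ℕ} (σ : Equiv.Perm (Fin k × Fin 2)) :
    0 ≤ (Equiv.Perm.sign σ : ℤ) * ∏ i, stdPairing (σ (i, 0)) (σ (i, 1)) := by
  by_cases h0 : ∃ i, stdPairing (σ (i, 0)) (σ (i, 1)) = 0
  · obtain ⟨i, hi⟩ := h0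
    rw [Finset.prod_eq_zero (Finset.mem_univ i) hi, mul_zero]
  push Not at h0
  have h1 : ∀ i, (σ (i, 0)).1 = (σ (i, 1)).1 := fun i => by
    by_contra h
    exact h0 i (by simp [stdPairing, h])
  let flip : Fin k → Equiv.Perm (Fin 2) := fun i => if (σ (i, 0)).2 = 0 then 1 else Equiv.swap 0 1
  have h2 : ∀ i, (σ (i, 0)).2 = flip i 0 ∧ (σ (i, 1)).2 = flip i 1 ∧
      stdPairing (σ (i, 0)) (σ (i, 1)) = (Equiv.Perm.sign (flip i) : ℤ) := fun i => by
    have := h0 i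
    simp only [stdPairing, h1 i, if_true, flip] at this ⊢
    generalize (σ (i, 0)).2 = a at *
    generalize (σ (i, 1)).2 = b at *
    fin_cases a <;> fin_cases b <;> simp_all
  have h3 : ∀ i c, σ (i, c) = ((σ (i, 0)).1, flip i c) := fun i c => by
    fin_cases c
    · exact Prod.ext rfl (h2 i).1
    · exact Prod.ext (h1 i).symm (h2 i).2.1
  have hinj : Function.Injective fun i => (σ (i, 0)).1 := fun i i' h => by
    have h4 : σ (i, (flip i).symm 0) = σ (i', (flip i').symm 0) := by
      rw [h3, h3 i']
      simp only [Equiv.apply_symm_apply]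
      rw [show (σ (i, 0)).1 = (σ (i', 0)).1 from h]
    exact congrArg Prod.fst (σ.injective h4)
  let π : Equiv.Perm (Fin k) := Equiv.ofBijective _ (Finite.injective_iff_bijective.1 hinj)
  -- The same `π` acts on both members of the pairs, so its sign occurs squared; only the flips
  -- contribute.
  have h5 : σ = Equiv.prodCongrLeft (fun _ : Fin 2 => π) * Equiv.prodCongrRight flip := by
    ext1 ⟨i, c⟩
    rw [h3]
    rfl
  have h6 : (Equiv.Perm.sign σ : ℤ) = ∏ i, (Equiv.Perm.sign (flip i) : ℤ) := by
    rw [h5, map_mul, Equiv.Perm.sign_prodCongrLeft, Equiv.Perm.sign_prodCongrRight, Fin.prod_univ_two,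
      Int.units_mul_self, one_mul, Units.coe_prod]
  rw [h6, Finset.prod_congr rfl fun i _ => (h2 i).2.2]
  exact mul_self_nonneg _

/-- An alternating form of degree `2k` on `ℂ²ᵏ` is a multiple of the determinant. The multiple is
computed for `Z = 1`, and a general `Z` is absorbed into a linear change of the `p`-coordinates, of
determinant `det Z`. Only the fact that `c` is real and nonzero matters later. -/
theorem exists_wedgePow_pairForm (k : ℕ) : ∃ c : ℝ, c ≠ 0 ∧
    ∀ (Z : Matrix (Fin k) (Fin k) ℂ) (v : Fin k × Fin 2 → Fin k × Fin 2 → ℂ),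
      wedgePow k (pairForm Z) v = c * (Z.det * (Matrix.of v).det) := by
  let n : ℤ := ∑ σ : Equiv.Perm (Fin k × Fin 2),
    (Equiv.Perm.sign σ : ℤ) * ∏ i, stdPairing (σ (i, 0)) (σ (i, 1))
  -- All terms are nonnegative and the identity permutation contributes `1`.
  have hn : 0 < n := by
    have h1 := Finset.single_le_sum (f := fun σ : Equiv.Perm (Fin k × Fin 2) =>
      (Equiv.Perm.sign σ : ℤ) * ∏ i, stdPairing (σ (i, 0)) (σ (i, 1)))
      (fun σ _ => sign_mul_prod_stdPairing_nonneg σ) (Finset.mem_univ 1)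
    refine lt_of_lt_of_le ?_ h1
    simp [stdPairing]
  have hstd : wedgePow k (pairForm (1 : Matrix (Fin k) (Fin k) ℂ)) (fun s => Pi.single s 1) =
      (1 / 2 : ℂ) ^ k * n := by
    simp only [wedgePow, pairForm_one_single, n]
    push_cast
    rfl
  refine ⟨(1 / 2) ^ k * n, by positivity, fun Z v => ?_⟩
  let T : Matrix (Fin k × Fin 2) (Fin k × Fin 2) ℂ := Matrix.blockDiagonal ![Zᵀ, 1]
  have hT0 : ∀ u i, (T *ᵥ u) (i, 0) = ∑ l, Z l i * u (l, 0) := fun u i => by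
    simp [T, Matrix.mulVec, dotProduct, Fintype.sum_prod_type, Matrix.blockDiagonal_apply]
  have hT1 : ∀ u i, (T *ᵥ u) (i, 1) = u (i, 1) := fun u i => by
    simp [T, Matrix.mulVec, dotProduct, Fintype.sum_prod_type, Matrix.blockDiagonal_apply,
      Matrix.one_apply]
  have hpair : ∀ u w, pairForm Z u w = pairForm 1 (T *ᵥ u) (T *ᵥ w) := fun u w => by
    simp only [pairForm, hT0, hT1, Matrix.one_apply, ite_mul, one_mul, zero_mul,
      Finset.sum_ite_eq, Finset.mem_univ, if_true, Finset.sum_mul, ← Finset.sum_sub_distrib]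
    rw [Finset.sum_comm]
    exact Finset.sum_congr rfl fun i _ => Finset.sum_congr rfl fun j _ => by ring
  have hTdet : T.det = Z.det := by
    simp [T, Matrix.det_blockDiagonal]
  have h1 : wedgePow k (pairForm Z) v = wedgePow k (fun a b => pairFormLin 1 a b)
      (fun s => T *ᵥ v s) := by
    simp only [wedgePow, hpair]
    rfl
  have h2 : (Matrix.of fun s => T *ᵥ v s) = Matrix.of v * Tᵀ := by
    ext s t
    simp [Matrix.mul_apply, Matrix.mulVec, dotProduct, mul_comm]
  have h3 := AlternatingMap.eq_smul_basis_det (Pi.basisFun ℂ (Fin k × Fin 2))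
    (MultilinearMap.alternatization (prodPairs (k := k) (pairFormLin 1)))
  have h4 := DFunLike.congr_fun h3 (fun s => T *ᵥ v s)
  rw [AlternatingMap.smul_apply, Pi.basisFun_det_apply, h2, Matrix.det_mul, Matrix.det_transpose,
    hTdet] at h4
  have h5 : (1 / 2 : ℂ) ^ k * MultilinearMap.alternatization
      (prodPairs (k := k) (pairFormLin 1)) (Pi.basisFun ℂ (Fin k × Fin 2)) = (1 / 2 : ℂ) ^ k * n := by
    rw [← hstd, ← wedgePow_eq_alternatization]
    congr 1
    ext s
    simp
  rw [h1, wedgePow_eq_alternatization, h4, smul_eq_mul, ← mul_assoc, h5]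
  push_cast
  ring

end WedgePow

/-! ### Unimodular coordinates and rational subspaces -/

section Integral

variable {m : ℕ}

/-- An integral matrix as a real matrix. -/
abbrev castMat (ξ : Matrix (Fin m) (Fin m) ℤ) : Matrix (Fin m) (Fin m) ℝ :=
  ξ.map (Int.cast : ℤ → ℝ)

theorem castMat_mul (ξ ζ : Matrix (Fin m) (Fin m) ℤ) :
    castMat (ξ * ζ) = castMat ξ * castMat ζ :=
  Matrix.map_mul (f := Int.castRingHom ℝ)

theorem castMat_mul_eq_one {ξ ζ : Matrix (Fin m) (Fin m) ℤ} (h : ξ * ζ = 1) :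
    castMat ξ * castMat ζ = 1 := by
  rw [← castMat_mul, h]
  exact Matrix.map_one _ Int.cast_zero Int.cast_one

theorem castMat_mulVec (ξ : Matrix (Fin m) (Fin m) ℤ) (n : Fin m → ℤ) :
    castMat ξ *ᵥ (fun i => (n i : ℝ)) = fun i => ((ξ *ᵥ n) i : ℝ) := by
  ext i
  simp [Matrix.mulVec, dotProduct]

/-- Two mutually inverse matrices as a continuous linear equivalence. -/
noncomputable def matEquiv {X Z : Matrix (Fin m) (Fin m) ℝ} (h : X * Z = 1) (h' : Z * X = 1) :
    Rn m ≃L[ℝ] Rn m :=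
  (Matrix.toLin'OfInv h' h).toContinuousLinearEquiv

@[simp]
theorem matEquiv_apply {X Z : Matrix (Fin m) (Fin m) ℝ} (h : X * Z = 1) (h' : Z * X = 1)
    (v : Rn m) : matEquiv h h' v = X *ᵥ v := by
  simp [matEquiv, Matrix.toLin'OfInv]

/-- A unimodular matrix preserves `ℤᵐ`, so a coordinate subspace plus the lattice is described by
integrality of the complementary coordinates. This turns the tori in the fibers into integrality
conditions. -/
theorem exists_add_integral_iff {ξ ζ : Matrix (Fin m) (Fin m) ℤ} (h : ξ * ζ = 1)
    (I : Fin m → Prop) (y : Rn m) :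
    (∃ w : Rn m, (∀ i, I i → (castMat ξ *ᵥ w) i = 0) ∧ ∃ n : Fin m → ℤ, y = w + fun i => (n i : ℝ)) ↔
      ∀ i, I i → ∃ n : ℤ, (castMat ξ *ᵥ y) i = n := by
  classical
  constructor
  · rintro ⟨w, hw, n, rfl⟩ i hi
    refine ⟨(ξ *ᵥ n) i, ?_⟩
    rw [Matrix.mulVec_add, Pi.add_apply, hw i hi, zero_add, castMat_mulVec]
  · intro hy
    choose n hn using hy
    -- The integers prescribed in `I` are completed by `0`; `ζ *ᵥ N` is then a lattice vector with
    -- the required components.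
    let N : Fin m → ℤ := fun i => if hi : I i then n i hi else 0
    refine ⟨y - fun i => ((ζ *ᵥ N) i : ℝ), fun i hi => ?_, ζ *ᵥ N, (sub_add_cancel _ _).symm⟩
    rw [Matrix.mulVec_sub, castMat_mulVec, Matrix.mulVec_mulVec, h, Matrix.one_mulVec, Pi.sub_apply,
      hn i hi]
    simp [N, hi]

/-- With `ζ` inverse to `ξ`, the entries of `ζᵀ d` are the coefficients of `d` in the basis of rows
of `ξ`, while those of `ξ w` are the pairings of `w` with these rows. So the subspace is read off by
`ζᵀ` and its annihilator by `ξ`. -/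
theorem IsRationalAffine.exists_coordinates {k : ℕ} {W : AffineSubspace ℝ (Rn m)}
    (hW : IsRationalAffine k W) :
    ∃ (ξ ζ : Matrix (Fin m) (Fin m) ℤ) (a : Rn m), ξ * ζ = 1 ∧ ζ * ξ = 1 ∧
      (∀ w, w ∈ W ↔ ∀ i : Fin m, ¬ (i : ℕ) < k → ((castMat ζ)ᵀ *ᵥ (w - a)) i = 0) ∧
      (∀ d, d ∈ W.direction ↔ ∀ i : Fin m, ¬ (i : ℕ) < k → ((castMat ζ)ᵀ *ᵥ d) i = 0) ∧
      (∀ w, (∀ d ∈ W.direction, d ⬝ᵥ w = 0) ↔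
        ∀ i : Fin m, (i : ℕ) < k → (castMat ξ *ᵥ w) i = 0) := by
  obtain ⟨ξ, a, hdet, rfl⟩ := hW
  have hu : IsUnit ξ.det := by
    rcases hdet with h | h <;> simp [h]
  have h1 : ξ * ξ⁻¹ = 1 := Matrix.mul_nonsing_inv ξ hu
  have h2 : ξ⁻¹ * ξ = 1 := Matrix.nonsing_inv_mul ξ hu
  have h3 : (castMat ξ⁻¹)ᵀ * (castMat ξ)ᵀ = 1 := by
    rw [← Matrix.transpose_mul, castMat_mul_eq_one h1, Matrix.transpose_one]
  have h4 : (castMat ξ)ᵀ * (castMat ξ⁻¹)ᵀ = 1 := by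
    rw [← Matrix.transpose_mul, castMat_mul_eq_one h2, Matrix.transpose_one]
  have hrow : ∀ i : Fin m, (fun j => ((ξ i j : ℤ) : ℝ)) = (castMat ξ)ᵀ *ᵥ Pi.single i 1 := fun i => by
    ext j
    simp
  have hspan : ∀ d, d ∈ Submodule.span ℝ {w | ∃ i : Fin m, (i : ℕ) < k ∧
      w = fun j => ((ξ i j : ℤ) : ℝ)} ↔
      ∀ i : Fin m, ¬ (i : ℕ) < k → ((castMat ξ⁻¹)ᵀ *ᵥ d) i = 0 := by
    intro d
    constructor
    · intro hd i hi
      induction hd using Submodule.span_induction with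
      | mem x hx =>
        obtain ⟨l, hl, rfl⟩ := hx
        rw [hrow, Matrix.mulVec_mulVec, h3, Matrix.one_mulVec, Pi.single_apply,
          if_neg (by rintro rfl; exact hi hl)]
      | zero => simp
      | add x y _ _ hx hy => rw [Matrix.mulVec_add, Pi.add_apply, hx, hy, add_zero]
      | smul c x _ hx => rw [Matrix.mulVec_smul, Pi.smul_apply, hx, smul_zero]
    · intro hd
      have h5 : d = ∑ i, ((castMat ξ⁻¹)ᵀ *ᵥ d) i • (fun j => ((ξ i j : ℤ) : ℝ)) := by
        conv_lhs => rw [← Matrix.one_mulVec d, ← h4, ← Matrix.mulVec_mulVec]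
        ext j
        simp [Matrix.mulVec, dotProduct, mul_comm]
      rw [h5]
      refine Submodule.sum_mem _ fun i _ => ?_
      by_cases hi : (i : ℕ) < k
      · exact Submodule.smul_mem _ _ (Submodule.subset_span ⟨i, hi, rfl⟩)
      · rw [hd i hi, zero_smul]
        exact Submodule.zero_mem _
  refine ⟨ξ, ξ⁻¹, a, h1, h2, fun w => ?_, fun d => ?_, fun w => ⟨fun hw i hi => ?_, fun hw d hd => ?_⟩⟩
  · rw [AffineSubspace.mem_mk', vsub_eq_sub, hspan]
  · rw [AffineSubspace.direction_mk', hspan]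
  · rw [AffineSubspace.direction_mk'] at hw
    exact hw _ (Submodule.subset_span ⟨i, hi, rfl⟩)
  · rw [AffineSubspace.direction_mk'] at hd
    induction hd using Submodule.span_induction with
    | mem x hx =>
      obtain ⟨l, hl, rfl⟩ := hx
      exact hw l hl
    | zero => simp
    | add x y _ _ hx hy => rw [add_dotProduct, hx, hy, add_zero]
    | smul c x _ hx => rw [smul_dotProduct, hx, smul_zero]

end Integral

/-! ### Changes of tropical charts and the two lattices -/

section Charts

variable {m : ℕ} {B : Type*} [TopologicalSpace B] [ChartedSpace (Rn m) B]

theorem sum_smul_dx_apply (e : TropChart m B) (p : B) (w : Rn m) (v : Tan m B p) :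
    (∑ i, w i • dx e p i) v = w ⬝ᵥ tanCoord e p v := by
  simp [dx, dotProduct]

variable [IsTropicalManifold m B]

theorem TropChart.mdifferentiable (e : TropChart m B) :
    e.1.MDifferentiable 𝓘(ℝ, Rn m) 𝓘(ℝ, Rn m) :=
  mdifferentiable_of_mem_atlas e.2

/-- The coordinates of tangent vectors, as an equivalence. -/
noncomputable def tanEquiv (e : TropChart m B) {p : B} (hp : p ∈ e.1.source) : Tan m B p ≃L[ℝ] Rn m :=
  (TropChart.mdifferentiable e).mfderiv hp

@[simp]
theorem tanEquiv_apply (e : TropChart m B) {p : B} (hp : p ∈ e.1.source) (v : Tan m B p) :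
    tanEquiv e hp v = tanCoord e p v := rfl

theorem tanCoord_tanVec (e : TropChart m B) {x : Rn m} (hx : x ∈ e.1.target) (y : Rn m) :
    tanCoord e (e.1.symm x) (tanVec e x y) = y :=
  DFunLike.congr_fun ((TropChart.mdifferentiable e).comp_symm_deriv hx) y

theorem transition_eventuallyEq (e e' : TropChart m B) {p : B} (hp : p ∈ e.1.source ∩ e'.1.source) :
    ∃ (A : Matrix (Fin m) (Fin m) ℤ) (b : Rn m),
      (fun x => e'.1 (e.1.symm x)) =ᶠ[nhds (e.1 p)] fun x => castMat A *ᵥ x + b := by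
  obtain ⟨A, b, h⟩ := IsTropicalManifold.transition e.1 e.2 e'.1 e'.2
  refine ⟨A, b, ?_⟩
  have h1 : e.1.symm ⁻¹' e'.1.source ∈ nhds (e.1 p) := by
    refine (e.1.continuousAt_symm (e.1.map_source hp.1)).preimage_mem_nhds
      (e'.1.open_source.mem_nhds ?_)
    rw [e.1.left_inv hp.1]
    exact hp.2
  filter_upwards [h1, e.1.open_target.mem_nhds (e.1.map_source hp.1)] with x hx hx'
  rw [h _ ⟨e.1.map_target hx', hx⟩, e.1.right_inv hx']

theorem hasFDerivAt_mulVec_add (A : Matrix (Fin m) (Fin m) ℝ) (b x : Rn m) :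
    HasFDerivAt (fun x => A *ᵥ x + b) (A.mulVecLin.toContinuousLinearMap) x :=
  (A.mulVecLin.toContinuousLinearMap.hasFDerivAt).add_const b

/-- The coordinate changes of tangent vectors are integral. -/
theorem exists_integral_transA (e e' : TropChart m B) {p : B}
    (hp : p ∈ e.1.source ∩ e'.1.source) :
    ∃ A : Matrix (Fin m) (Fin m) ℤ, transA e e' p = (castMat A)ᵀ ∧
      HasFDerivAt (fun x => e'.1 (e.1.symm x)) ((castMat A).mulVecLin.toContinuousLinearMap)
        (e.1 p) ∧
      ∀ v : Tan m B p, tanCoord e' p v = castMat A *ᵥ tanCoord e p v := by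
  obtain ⟨A, b, h⟩ := transition_eventuallyEq e e' hp
  have h1 : HasFDerivAt (fun x => e'.1 (e.1.symm x)) ((castMat A).mulVecLin.toContinuousLinearMap)
      (e.1 p) := (hasFDerivAt_mulVec_add _ b _).congr_of_eventuallyEq h
  refine ⟨A, ?_, h1, fun v => ?_⟩
  · ext j i
    rw [transA, Matrix.of_apply, h1.fderiv]
    simp
  · have h2 : e'.1 =ᶠ[nhds p] (fun x => e'.1 (e.1.symm x)) ∘ e.1 := by
      filter_upwards [e.1.open_source.mem_nhds hp.1] with q hq
      simp [e.1.left_inv hq]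
    have h3 : mfderiv 𝓘(ℝ, Rn m) 𝓘(ℝ, Rn m) e'.1 p =
        (mfderiv 𝓘(ℝ, Rn m) 𝓘(ℝ, Rn m) (fun x => e'.1 (e.1.symm x)) (e.1 p)).comp
          (mfderiv 𝓘(ℝ, Rn m) 𝓘(ℝ, Rn m) e.1 p) := by
      rw [h2.mfderiv_eq]
      exact mfderiv_comp p h1.differentiableAt.mdifferentiableAt
        ((TropChart.mdifferentiable e).mdifferentiableAt hp.1)
    rw [mfderiv_eq_fderiv, h1.fderiv] at h3
    exact DFunLike.congr_fun h3 v

/-- The lattice is generated from all charts at once; integrality of the coordinate changes shows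
that a single chart already determines it. -/
theorem mem_lattice_iff (e : TropChart m B) {p : B} (hp : p ∈ e.1.source) (v : Tan m B p) :
    v ∈ lattice m B p ↔ ∃ n : Fin m → ℤ, tanCoord e p v = fun i => (n i : ℝ) := by
  constructor
  · intro hv
    induction hv using Submodule.span_induction with
    | mem v hv =>
      obtain ⟨e', hp', i, hv⟩ := hv
      obtain ⟨A, -, -, hA⟩ := exists_integral_transA e' e ⟨hp', hp⟩
      refine ⟨A *ᵥ Pi.single i 1, ?_⟩
      rw [hA, hv, ← castMat_mulVec]
      congr 1
      ext j
      simp [Pi.single_apply]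
    | zero => exact ⟨0, by rw [map_zero]; ext; simp⟩
    | add x y _ _ hx hy =>
      obtain ⟨n, hn⟩ := hx
      obtain ⟨n', hn'⟩ := hy
      exact ⟨n + n', by rw [map_add, hn, hn']; ext; simp⟩
    | smul c x _ hx =>
      obtain ⟨n, hn⟩ := hx
      exact ⟨c • n, by rw [map_zsmul, hn]; ext; simp⟩
  · rintro ⟨n, hn⟩
    have h1 : v = ∑ i, n i • (tanEquiv e hp).symm (Pi.single i 1) := by
      apply (tanEquiv e hp).injective
      rw [tanEquiv_apply, hn, map_sum]
      simp only [map_zsmul, ContinuousLinearEquiv.apply_symm_apply]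
      ext j
      simp [Pi.single_apply]
    rw [h1]
    refine Submodule.sum_mem _ fun i _ => Submodule.smul_mem _ _ (Submodule.subset_span ?_)
    exact ⟨e, hp, i, (tanEquiv e hp).apply_symm_apply _⟩

theorem sum_smul_dx_eq (e e' : TropChart m B) {p : B} (hp : p ∈ e.1.source ∩ e'.1.source)
    (w : Rn m) : ∑ i, w i • dx e' p i = ∑ i, (transA e e' p *ᵥ w) i • dx e p i := by
  obtain ⟨A, hA, -, hA'⟩ := exists_integral_transA e e' hp
  ext v
  rw [sum_smul_dx_apply, sum_smul_dx_apply, hA', hA, Matrix.mulVec_transpose,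
    Matrix.dotProduct_mulVec]

theorem sum_smul_dx_injective (e : TropChart m B) {p : B} (hp : p ∈ e.1.source) :
    Function.Injective fun w : Rn m => ∑ i, w i • dx e p i := by
  intro w w' h
  ext i
  have h1 := DFunLike.congr_fun h ((tanEquiv e hp).symm (Pi.single i 1))
  have h2 : tanCoord e p ((tanEquiv e hp).symm (Pi.single i 1)) = Pi.single i 1 :=
    (tanEquiv e hp).apply_symm_apply _
  simp only [sum_smul_dx_apply, h2] at h1
  simpa using h1

/-- Covectors change by the transpose of an integral matrix, so the generators from other charts are
again integral combinations of the `dx_i` of the given chart. -/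
theorem mem_dualLattice_iff (e : TropChart m B) {p : B} (hp : p ∈ e.1.source) (w : Rn m) :
    ∑ i, w i • dx e p i ∈ dualLattice m B p ↔ ∃ n : Fin m → ℤ, w = fun i => (n i : ℝ) := by
  have key : ∀ η ∈ dualLattice m B p, ∃ n : Fin m → ℤ, η = ∑ i, (n i : ℝ) • dx e p i := by
    intro η hη
    induction hη using Submodule.span_induction with
    | mem η hη =>
      obtain ⟨e', hp', i, rfl⟩ := hη
      obtain ⟨A, hA, -, -⟩ := exists_integral_transA e e' ⟨hp, hp'⟩
      refine ⟨A i, ?_⟩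
      have h := sum_smul_dx_eq e e' ⟨hp, hp'⟩ (Pi.single i 1)
      rw [hA] at h
      simpa [Pi.single_apply] using h
    | zero => exact ⟨0, by simp⟩
    | add x y _ _ hx hy =>
      obtain ⟨n, rfl⟩ := hx
      obtain ⟨n', rfl⟩ := hy
      exact ⟨n + n', by simp [add_smul, Finset.sum_add_distrib]⟩
    | smul c x _ hx =>
      obtain ⟨n, rfl⟩ := hx
      refine ⟨c • n, ?_⟩
      rw [Finset.smul_sum]
      refine Finset.sum_congr rfl fun i _ => ?_
      rw [← Int.cast_smul_eq_zsmul ℝ, smul_smul]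
      simp
  constructor
  · intro h
    obtain ⟨n, hn⟩ := key _ h
    exact ⟨n, sum_smul_dx_injective e hp hn⟩
  · rintro ⟨n, rfl⟩
    refine Submodule.sum_mem _ fun i _ => ?_
    have h1 : n i • dx e p i ∈ dualLattice m B p :=
      Submodule.smul_mem _ _ (Submodule.subset_span ⟨e, hp, i, rfl⟩)
    rw [← Int.cast_smul_eq_zsmul ℝ] at h1
    exact h1

end Charts

/-! ### The Legendre transform and its derivative -/

section Legendre

variable {m : ℕ} {B : Type*} [TopologicalSpace B] [ChartedSpace (Rn m) B]
  (K : ConvexMultivalued m B) (e : TropChart m B)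

theorem apply_eq_dotProduct (α : Rn m →L[ℝ] ℝ) (v : Rn m) :
    α v = (fun i => α (Pi.single i 1)) ⬝ᵥ v := by
  conv_lhs => rw [pi_eq_sum_univ' v, map_sum]
  refine Finset.sum_congr rfl fun i _ => ?_
  rw [map_smul, smul_eq_mul, mul_comm]

theorem contDiffOn_legendre : ContDiffOn ℝ ∞ (legendre K e) e.1.target :=
  contDiffOn_pi.2 fun _ =>
    ((K.smooth e).fderiv_of_isOpen e.1.open_target (m := ∞) (by simp)).clm_apply contDiffOn_const

theorem hess_posDef {x : Rn m} (hx : x ∈ e.1.target) : (hess K e x).PosDef :=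
  K.convex e x hx

theorem hess_transpose {x : Rn m} (hx : x ∈ e.1.target) : (hess K e x)ᵀ = hess K e x := by
  have h := (hess_posDef K e hx).isHermitian
  rwa [Matrix.IsHermitian, Matrix.conjTranspose_eq_transpose_of_trivial] at h

/-- The definition of `hess` yields the transposed Jacobian of `x̃`; symmetry, which is part of
positive definiteness, removes the transpose. -/
theorem hasFDerivAt_legendre {x : Rn m} (hx : x ∈ e.1.target) :
    HasFDerivAt (legendre K e) ((hess K e x).mulVecLin.toContinuousLinearMap) x := by
  have h1 : DifferentiableAt ℝ (legendre K e) x :=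
    ((contDiffOn_legendre K e).contDiffAt (e.1.open_target.mem_nhds hx)).differentiableAt (by simp)
  refine hasFDerivAt_pi'.2 fun j => ?_
  have h2 : HasFDerivAt (fun x => legendre K e x j) (fderiv ℝ (fun x => legendre K e x j) x) x :=
    (differentiableAt_pi.1 h1 j).hasFDerivAt
  suffices h3 : (ContinuousLinearMap.proj (R := ℝ) (φ := fun _ : Fin m => ℝ) j).comp
      ((hess K e x).mulVecLin.toContinuousLinearMap) = fderiv ℝ (fun x => legendre K e x j) x by
    rwa [h3]
  refine ContinuousLinearMap.ext fun v => ?_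
  rw [apply_eq_dotProduct (fderiv ℝ (fun x => legendre K e x j) x) v]
  change (hess K e x *ᵥ v) j = _
  conv_lhs => rw [← hess_transpose K e hx]
  rfl

end Legendre

/-! ### Independence of the chart: `B(V)`, `L(V,Y)` and `C(V)` -/

section Glue

variable {m : ℕ} {B : Type*} [TopologicalSpace B] [ChartedSpace (Rn m) B]
  {K : ConvexMultivalued m B} {k : ℕ} {V : AffineSection K k}

theorem AffineSection.direction_eq {e e' : TropChart m B} {p : B}
    (hp : p ∈ e.1.source ∩ e'.1.source) :
    (V.loc e p).direction = (V.loc e' p).direction.map (transA e e' p).mulVecLin := by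
  let f : Rn m →ᵃ[ℝ] Rn m :=
    (transA e e' p).mulVecLin.toAffineMap + AffineMap.const ℝ (Rn m) (transB K e e' p)
  have h1 : V.loc e p = (V.loc e' p).map f := SetLike.coe_injective (V.glue e e' p hp)
  have h2 : f.linear = (transA e e' p).mulVecLin := by simp [f]
  rw [h1, AffineSubspace.map_direction, h2]

variable [IsTropicalManifold m B]

/-- The chain rule applied to `K_μ` composed with the coordinate change. The resulting affine
transformation is the one that glues the `V_λ`, so the condition `x̃ ∈ V_λ` has the same meaning in
every chart. -/
theorem legendre_transition (K : ConvexMultivalued m B) (e e' : TropChart m B) {p : B}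
    (hp : p ∈ e.1.source ∩ e'.1.source) :
    legendre K e (e.1 p) = transA e e' p *ᵥ legendre K e' (e'.1 p) + transB K e e' p := by
  obtain ⟨A, hA, hτ, -⟩ := exists_integral_transA e e' hp
  have hd : ∀ (e : TropChart m B), p ∈ e.1.source →
      DifferentiableAt ℝ (fun x => K.K e (e.1.symm x)) (e.1 p) := fun e hp =>
    ((K.smooth e).contDiffAt (e.1.open_target.mem_nhds (e.1.map_source hp))).differentiableAt
      (by simp)
  have h1 : (fun x => K.K e' (e.1.symm x)) =ᶠ[nhds (e.1 p)]
      (fun x => K.K e' (e'.1.symm x)) ∘ fun x => e'.1 (e.1.symm x) := by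
    have h1 : e.1.symm ⁻¹' e'.1.source ∈ nhds (e.1 p) := by
      refine (e.1.continuousAt_symm (e.1.map_source hp.1)).preimage_mem_nhds
        (e'.1.open_source.mem_nhds ?_)
      rw [e.1.left_inv hp.1]
      exact hp.2
    filter_upwards [h1] with x hx
    rw [Function.comp_apply, e'.1.left_inv hx]
  have h2 : HasFDerivAt (fun x => K.K e' (e.1.symm x))
      ((fderiv ℝ (fun x => K.K e' (e'.1.symm x)) (e'.1 p)).comp
        ((castMat A).mulVecLin.toContinuousLinearMap)) (e.1 p) := by
    refine HasFDerivAt.congr_of_eventuallyEq ?_ h1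
    refine HasFDerivAt.comp (e.1 p) ?_ hτ
    rw [e.1.left_inv hp.1]
    exact (hd e' hp.2).hasFDerivAt
  ext j
  rw [Pi.add_apply, transB, ((hd e hp.1).hasFDerivAt.fun_sub h2).fderiv, hA]
  rw [sub_apply, ContinuousLinearMap.comp_apply, apply_eq_dotProduct
    (fderiv ℝ (fun x => K.K e' (e'.1.symm x)) (e'.1 p))]
  change legendre K e (e.1 p) j = ((castMat A)ᵀ *ᵥ legendre K e' (e'.1 p)) j +
    (legendre K e (e.1 p) j - legendre K e' (e'.1 p) ⬝ᵥ (castMat A *ᵥ Pi.single j 1))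
  rw [Matrix.dotProduct_mulVec, Matrix.mulVec_transpose, dotProduct_single, mul_one]
  ring

theorem AffineSection.mem_localBase_of_mem {e e' : TropChart m B} {p : B} (hp : p ∈ e.1.source)
    (h : p ∈ V.localBase e') : p ∈ V.localBase e := by
  refine ⟨hp, ?_⟩
  rw [legendre_transition K e e' ⟨hp, h.1⟩]
  have h1 := V.glue e e' p ⟨hp, h.1⟩
  rw [← SetLike.mem_coe, h1]
  exact ⟨_, h.2, rfl⟩

theorem AffineSection.mem_base_iff {e : TropChart m B} {p : B} (hp : p ∈ e.1.source) :
    p ∈ V.base ↔ p ∈ V.localBase e := by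
  constructor
  · intro h
    obtain ⟨e', he'⟩ := Set.mem_iUnion.1 h
    exact mem_localBase_of_mem hp he'
  · exact fun h => Set.mem_iUnion.2 ⟨e, h⟩

/-- The definition lets the witness live in any chart. It can be moved to the chart `e` because
annihilators of the linear parts transform dually to these linear parts, that is, like tangent
vectors. -/
theorem mem_lagrangian_iff {Y : ∀ p : B, Tan m B p} {e : TropChart m B} {p : B}
    (hp : p ∈ e.1.source) (v : Tan m B p) :
    ((⟨p, Submodule.Quotient.mk v⟩ : XB m B) ∈ lagrangian V Y) ↔ p ∈ V.localBase e ∧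
      ∃ w : Rn m, (∀ d ∈ (V.loc e p).direction, d ⬝ᵥ w = 0) ∧
        ∃ n : Fin m → ℤ, tanCoord e p v - tanCoord e p (Y p) = w + fun i => (n i : ℝ) := by
  constructor
  · rintro ⟨e', x', w', hx', hb, hw', h⟩
    obtain ⟨rfl, h⟩ := Sigma.mk.inj_iff.1 h
    have h := (Submodule.Quotient.eq _).1 (eq_of_heq h)
    obtain ⟨n, hn⟩ := (mem_lattice_iff e hp _).1 h
    have hpp := e'.1.map_target hx'
    obtain ⟨A, hA, -, hA'⟩ := exists_integral_transA e e' ⟨hp, hpp⟩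
    refine ⟨AffineSection.mem_localBase_of_mem hp hb,
      tanCoord e _ (tanVec e' x' w'), fun d hd => ?_, n, ?_⟩
    · rw [AffineSection.direction_eq ⟨hp, hpp⟩] at hd
      obtain ⟨d', hd', rfl⟩ := hd
      rw [Matrix.mulVecLin_apply, hA, Matrix.mulVec_transpose, ← Matrix.dotProduct_mulVec, ← hA',
        tanCoord_tanVec e' hx']
      exact hw' d' hd'
    · rw [← hn, map_sub, map_add]
      abel
  · rintro ⟨hb, w, hw, n, h⟩
    have hl : e.1.symm (e.1 p) = p := e.1.left_inv hp
    refine ⟨e, e.1 p, w, e.1.map_source hp, by rwa [hl], by rwa [hl], ?_⟩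
    have h1 : (⟨p, Submodule.Quotient.mk ((tanEquiv e hp).symm w + Y p)⟩ : XB m B) =
        ⟨e.1.symm (e.1 p), Submodule.Quotient.mk (tanVec e (e.1 p) w + Y (e.1.symm (e.1 p)))⟩ := by
      -- The base point `e.1.symm (e.1 p)` is only propositionally equal to `p`, and the fiber
      -- depends on it; a variable `q` allows substitution.
      have h2 : ∀ (q : B) (hq : q ∈ e.1.source) (u : Tan m B q), q = p → tanCoord e q u = w →
          (⟨p, Submodule.Quotient.mk ((tanEquiv e hp).symm w + Y p)⟩ : XB m B) =
            ⟨q, Submodule.Quotient.mk (u + Y q)⟩ := by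
        rintro q hq u rfl rfl
        rw [← tanEquiv_apply e hp, ContinuousLinearEquiv.symm_apply_apply]
      exact h2 _ (by rwa [hl]) _ hl (tanCoord_tanVec e (e.1.map_source hp) w)
    rw [← h1, Sigma.mk.inj_iff]
    refine ⟨rfl, heq_of_eq ((Submodule.Quotient.eq _).2 ((mem_lattice_iff e hp _).2 ⟨n, ?_⟩))⟩
    have h3 : tanCoord e p ((tanEquiv e hp).symm w) = w := (tanEquiv e hp).apply_symm_apply w
    rw [map_sub, map_add, h3, add_comm, ← sub_sub, h]
    abel

theorem mem_complexSub_iff {e : TropChart m B} {p : B} (hp : p ∈ e.1.source) (y : Rn m) :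
    ((⟨p, Submodule.Quotient.mk (∑ i, y i • dx e p i)⟩ : WB m B) ∈ complexSub V) ↔
      p ∈ V.localBase e ∧ ∃ w : Rn m, w ∈ (V.loc e p).direction ∧
        ∃ n : Fin m → ℤ, y = w + fun i => (n i : ℝ) := by
  have key : ∀ w : Rn m, (Submodule.Quotient.mk (∑ i, y i • dx e p i) :
      Cotan m B p ⧸ dualLattice m B p) = Submodule.Quotient.mk (∑ i, w i • dx e p i) ↔
      ∃ n : Fin m → ℤ, y = w + fun i => (n i : ℝ) := fun w => by
    have h : ∑ i, y i • dx e p i - ∑ i, w i • dx e p i = ∑ i, (y - w) i • dx e p i := by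
      rw [← Finset.sum_sub_distrib]
      exact Finset.sum_congr rfl fun i _ => (sub_smul _ _ _).symm
    rw [Submodule.Quotient.eq, h]
    refine (mem_dualLattice_iff e hp (y - w)).trans ?_
    simp only [sub_eq_iff_eq_add']
  constructor
  · rintro ⟨e', p', w', hb, hw', h⟩
    obtain ⟨rfl, h⟩ := Sigma.mk.inj_iff.1 h
    have h := eq_of_heq h
    rw [sum_smul_dx_eq e e' ⟨hp, hb.1⟩, key] at h
    refine ⟨AffineSection.mem_localBase_of_mem hp hb, _, ?_, h⟩
    rw [AffineSection.direction_eq ⟨hp, hb.1⟩]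
    exact ⟨w', hw', rfl⟩
  · rintro ⟨hb, w, hw, h⟩
    exact ⟨e, p, w, hb, hw, Sigma.mk.inj_iff.2 ⟨rfl, heq_of_eq ((key w).2 h)⟩⟩

end Glue

/-! ### Linear models of the tangent spaces -/

section Inclusion

variable {m k : ℕ}

/-- The inclusion of `ℝᵏ` into `ℝᵐ` as the first coordinates. -/
def inclMat (hk : k ≤ m) : Matrix (Fin m) (Fin k) ℝ :=
  Matrix.of fun i l => if i = Fin.castLE hk l then 1 else 0

theorem inclMat_mulVec_castLE (hk : k ≤ m) (f : Fin k → ℝ) (l : Fin k) :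
    (inclMat hk *ᵥ f) (Fin.castLE hk l) = f l := by
  simp [inclMat, Matrix.mulVec, dotProduct]

theorem inclMat_mulVec_of_not_lt (hk : k ≤ m) (f : Fin k → ℝ) {i : Fin m} (hi : ¬ (i : ℕ) < k) :
    (inclMat hk *ᵥ f) i = 0 := by
  simp only [inclMat, Matrix.mulVec, dotProduct, Matrix.of_apply]
  refine Finset.sum_eq_zero fun l _ => ?_
  rw [if_neg (by rintro rfl; exact hi l.2), zero_mul]

theorem inclMat_transpose_mulVec (hk : k ≤ m) (s : Rn m) (l : Fin k) :
    ((inclMat hk)ᵀ *ᵥ s) l = s (Fin.castLE hk l) := by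
  simp [inclMat, Matrix.mulVec, dotProduct]

theorem inclMat_transpose_mulVec_mulVec (hk : k ≤ m) (f : Fin k → ℝ) :
    (inclMat hk)ᵀ *ᵥ (inclMat hk *ᵥ f) = f := by
  ext l
  rw [inclMat_transpose_mulVec, inclMat_mulVec_castLE]

theorem inclMat_mulVec_transpose_mulVec (hk : k ≤ m) (s : Rn m) (i : Fin m) :
    (inclMat hk *ᵥ ((inclMat hk)ᵀ *ᵥ s)) i = if (i : ℕ) < k then s i else 0 := by
  split_ifs with hi
  · have h := inclMat_mulVec_castLE hk ((inclMat hk)ᵀ *ᵥ s) ⟨i, hi⟩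
    rwa [inclMat_transpose_mulVec] at h
  · exact inclMat_mulVec_of_not_lt hk _ hi

theorem inclMat_mulVec_transpose_mulVec_eq (hk : k ≤ m) {s : Rn m}
    (hs : ∀ i : Fin m, ¬ (i : ℕ) < k → s i = 0) :
    inclMat hk *ᵥ ((inclMat hk)ᵀ *ᵥ s) = s := by
  ext i
  rw [inclMat_mulVec_transpose_mulVec]
  split_ifs with hi
  · rfl
  · exact (hs i hi).symm

/-- The model of the tangent spaces of `L(V,Y)`. -/
noncomputable def modelX (hk : k ≤ m) : Rn m →L[ℝ] Rn m × Rn m :=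
  ((inclMat hk * (inclMat hk)ᵀ).mulVecLin.prod
    (LinearMap.id - (inclMat hk * (inclMat hk)ᵀ).mulVecLin)).toContinuousLinearMap

theorem modelX_apply (hk : k ≤ m) (u : Rn m) :
    modelX hk u = (inclMat hk *ᵥ ((inclMat hk)ᵀ *ᵥ u), u - inclMat hk *ᵥ ((inclMat hk)ᵀ *ᵥ u)) := by
  rw [Matrix.mulVec_mulVec]
  rfl

theorem isCoordModel_modelX (hk : k ≤ m) :
    IsCoordModel (fun i : Fin m => (i : ℕ) < k) (fun i : Fin m => (i : ℕ) < k) (modelX hk)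
      (ContinuousLinearMap.fst ℝ _ _ + ContinuousLinearMap.snd ℝ _ _) where
  left_inv u := by simp [modelX_apply]
  fst_zero u i hi := by
    rw [modelX_apply]
    exact inclMat_mulVec_of_not_lt hk _ hi
  snd_zero u i hi := by simp [modelX_apply, inclMat_mulVec_transpose_mulVec, hi, -Matrix.mulVec_mulVec]
  right_inv z h1 h2 := by
    have h3 : inclMat hk *ᵥ ((inclMat hk)ᵀ *ᵥ (z.1 + z.2)) = z.1 := by
      ext i
      rw [inclMat_mulVec_transpose_mulVec]
      split_ifs with hi
      · simp [h2 i hi]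
      · exact (h1 i hi).symm
    rw [modelX_apply]
    exact Prod.ext h3 (by simp [h3, -Matrix.mulVec_mulVec])

/-- The real parts of a complex vector. -/
noncomputable def rePart (u : Fin k → ℂ) : Fin k → ℝ := fun l => (u l).re

/-- The imaginary parts of a complex vector. -/
noncomputable def imPart (u : Fin k → ℂ) : Fin k → ℝ := fun l => (u l).im

/-- The model of the tangent spaces of `C(V)`. -/
noncomputable def modelW (hk : k ≤ m) : (Fin k → ℂ) →L[ℝ] Rn m × Rn m :=
  LinearMap.toContinuousLinearMap
    { toFun := fun u => (inclMat hk *ᵥ rePart u, inclMat hk *ᵥ imPart u)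
      map_add' := fun u v => by
        rw [Prod.mk_add_mk, ← Matrix.mulVec_add, ← Matrix.mulVec_add]
        rfl
      map_smul' := fun c u => by
        rw [RingHom.id_apply, Prod.smul_mk, ← Matrix.mulVec_smul, ← Matrix.mulVec_smul]
        congr 3 <;> ext l <;> simp [rePart, imPart] }

theorem modelW_apply (hk : k ≤ m) (u : Fin k → ℂ) :
    modelW hk u = (inclMat hk *ᵥ rePart u, inclMat hk *ᵥ imPart u) := rfl

/-- The inverse of the model of the tangent spaces of `C(V)`. -/
noncomputable def modelWInv (hk : k ≤ m) : Rn m × Rn m →L[ℝ] (Fin k → ℂ) :=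
  LinearMap.toContinuousLinearMap
    { toFun := fun z l => ⟨z.1 (Fin.castLE hk l), z.2 (Fin.castLE hk l)⟩
      map_add' := fun u v => rfl
      map_smul' := fun c u => by
        ext l
        refine Complex.ext ?_ ?_ <;> simp }

theorem isCoordModel_modelW (hk : k ≤ m) :
    IsCoordModel (fun i : Fin m => (i : ℕ) < k) (fun i : Fin m => ¬ (i : ℕ) < k) (modelW hk)
      (modelWInv hk) where
  left_inv u := by
    ext l
    exact Complex.ext (inclMat_mulVec_castLE hk _ l) (inclMat_mulVec_castLE hk _ l)
  fst_zero u i hi := inclMat_mulVec_of_not_lt hk _ hi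
  snd_zero u i hi := inclMat_mulVec_of_not_lt hk _ hi
  right_inv z h1 h2 := by
    have h3 : ∀ s : Rn m, (inclMat hk)ᵀ *ᵥ s = fun l => s (Fin.castLE hk l) := fun s => by
      ext l
      rw [inclMat_transpose_mulVec]
    have h4 := inclMat_mulVec_transpose_mulVec_eq hk h1
    have h5 := inclMat_mulVec_transpose_mulVec_eq hk h2
    rw [h3] at h4 h5
    exact Prod.ext h4 h5

end Inclusion

/-! ### Coordinates that straighten `V`; the submanifold statements -/

section FlatChart

variable {m : ℕ} {B : Type*} [TopologicalSpace B] [ChartedSpace (Rn m) B]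
  {K : ConvexMultivalued m B} {k : ℕ}

/-- Integral coordinates in which the local expression of a constant section is a coordinate
subspace. -/
structure FlatChart (V : AffineSection K k) (e : TropChart m B) where
  /-- the rows are an integral basis whose first members span the linear part -/
  ξ : Matrix (Fin m) (Fin m) ℤ
  /-- the inverse of `ξ` -/
  ζ : Matrix (Fin m) (Fin m) ℤ
  /-- a point of the affine subspace -/
  a : Rn m
  mul_inv : ξ * ζ = 1
  inv_mul : ζ * ξ = 1
  mem_loc : ∀ p ∈ e.1.source, ∀ w, w ∈ V.loc e p ↔
    ∀ i : Fin m, ¬ (i : ℕ) < k → ((castMat ζ)ᵀ *ᵥ (w - a)) i = 0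
  mem_direction : ∀ p ∈ e.1.source, ∀ d, d ∈ (V.loc e p).direction ↔
    ∀ i : Fin m, ¬ (i : ℕ) < k → ((castMat ζ)ᵀ *ᵥ d) i = 0
  mem_annihilator : ∀ p ∈ e.1.source, ∀ w, (∀ d ∈ (V.loc e p).direction, d ⬝ᵥ w = 0) ↔
    ∀ i : Fin m, (i : ℕ) < k → (castMat ξ *ᵥ w) i = 0

theorem AffineSection.IsConstant.nonempty_flatChart {V : AffineSection K k} (hV : V.IsConstant)
    (e : TropChart m B) : Nonempty (FlatChart V e) := by
  obtain ⟨W, hW, h⟩ := hV e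
  obtain ⟨ξ, ζ, a, h1, h2, h3, h4, h5⟩ := hW.exists_coordinates
  exact ⟨⟨ξ, ζ, a, h1, h2, fun p hp => by rwa [h p hp], fun p hp => by rwa [h p hp],
    fun p hp => by rwa [h p hp]⟩⟩

namespace FlatChart

variable {V : AffineSection K k} {e : TropChart m B} (c : FlatChart V e)

/-- The matrix `ξ` over the reals. -/
abbrev X : Matrix (Fin m) (Fin m) ℝ := castMat c.ξ

/-- The matrix `ζ` over the reals. -/
abbrev Z : Matrix (Fin m) (Fin m) ℝ := castMat c.ζ

theorem X_mul_Z : c.X * c.Z = 1 := castMat_mul_eq_one c.mul_inv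

theorem Z_mul_X : c.Z * c.X = 1 := castMat_mul_eq_one c.inv_mul

theorem transpose_Z_mul_X : c.Zᵀ * c.Xᵀ = 1 := by
  rw [← Matrix.transpose_mul, c.X_mul_Z, Matrix.transpose_one]

theorem transpose_X_mul_Z : c.Xᵀ * c.Zᵀ = 1 := by
  rw [← Matrix.transpose_mul, c.Z_mul_X, Matrix.transpose_one]

/-- The coordinates `x̃` with respect to the basis `ξ` and the origin `a`. -/
noncomputable def F (x : Rn m) : Rn m := c.Zᵀ *ᵥ (legendre K e x - c.a)

/-- The coordinates of the points of `B(V)`. -/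
def slice : Set (Rn m) := zeroSlice e.1.target c.F fun i => (i : ℕ) < k

theorem contDiffOn_F : ContDiffOn ℝ ∞ c.F e.1.target :=
  c.Zᵀ.mulVecLin.toContinuousLinearMap.contDiff.comp_contDiffOn
    ((contDiffOn_legendre K e).sub contDiffOn_const)

theorem hess_mul_inv {x : Rn m} (hx : x ∈ e.1.target) : hess K e x * (hess K e x)⁻¹ = 1 :=
  Matrix.mul_nonsing_inv _ ((Matrix.isUnit_iff_isUnit_det _).1 (hess_posDef K e hx).isUnit)

theorem inv_mul_hess {x : Rn m} (hx : x ∈ e.1.target) : (hess K e x)⁻¹ * hess K e x = 1 :=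
  Matrix.nonsing_inv_mul _ ((Matrix.isUnit_iff_isUnit_det _).1 (hess_posDef K e hx).isUnit)

/-- The derivative of `F`. -/
noncomputable def F' {x : Rn m} (hx : x ∈ e.1.target) : Rn m ≃L[ℝ] Rn m :=
  matEquiv (X := c.Zᵀ * hess K e x) (Z := (hess K e x)⁻¹ * c.Xᵀ)
    (by rw [Matrix.mul_assoc, ← Matrix.mul_assoc (hess K e x), hess_mul_inv hx, Matrix.one_mul,
      c.transpose_Z_mul_X])
    (by rw [Matrix.mul_assoc, ← Matrix.mul_assoc c.Xᵀ, c.transpose_X_mul_Z, Matrix.one_mul,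
      inv_mul_hess hx])

theorem F'_apply {x : Rn m} (hx : x ∈ e.1.target) (v : Rn m) :
    c.F' hx v = c.Zᵀ *ᵥ (hess K e x *ᵥ v) := by
  rw [F', matEquiv_apply, Matrix.mulVec_mulVec]

theorem hasFDerivAt_F {x : Rn m} (hx : x ∈ e.1.target) :
    HasFDerivAt c.F (c.F' hx : Rn m →L[ℝ] Rn m) x := by
  have h := c.Zᵀ.mulVecLin.toContinuousLinearMap.hasFDerivAt.comp x
    ((hasFDerivAt_legendre K e hx).sub_const c.a)
  have h2 : (c.F' hx : Rn m →L[ℝ] Rn m) = c.Zᵀ.mulVecLin.toContinuousLinearMap.comp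
      ((hess K e x).mulVecLin.toContinuousLinearMap) :=
    ContinuousLinearMap.ext fun v => c.F'_apply hx v
  rw [h2]
  exact h

/-- The integral coordinates of tangent vectors. -/
noncomputable abbrev equivX : Rn m ≃L[ℝ] Rn m := matEquiv c.X_mul_Z c.Z_mul_X

/-- The integral coordinates of cotangent vectors. -/
noncomputable abbrev equivW : Rn m ≃L[ℝ] Rn m := matEquiv c.transpose_Z_mul_X c.transpose_X_mul_Z

theorem mem_localBase_iff {x : Rn m} (hx : x ∈ e.1.target) :
    e.1.symm x ∈ V.localBase e ↔ x ∈ c.slice := by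
  have hp := e.1.map_target hx
  simp only [AffineSection.localBase, Set.mem_ofPred_eq, hp, true_and, c.mem_loc _ hp,
    e.1.right_inv hx, slice, zeroSlice, hx, F]

variable [IsTropicalManifold m B] (Y : ∀ p : B, Tan m B p)

theorem setOf_mem_base_eq : {x | x ∈ e.1.target ∧ e.1.symm x ∈ V.base} = c.slice := by
  ext x
  constructor
  · rintro ⟨hx, h⟩
    exact (c.mem_localBase_iff hx).1 ((AffineSection.mem_base_iff (e.1.map_target hx)).1 h)
  · intro h
    exact ⟨h.1, (AffineSection.mem_base_iff (e.1.map_target h.1)).2 ((c.mem_localBase_iff h.1).2 h)⟩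

theorem contDiffOn_vecCoord {Y : ∀ p : B, Tan m B p} (hY : IsSmoothAlong V Y) :
    ContDiffOn ℝ ∞ (vecCoord Y e) c.slice :=
  c.setOf_mem_base_eq ▸ hY e

theorem xRead_lagrangian : xRead e (lagrangian V Y) =
    fiberedSet e.1.target c.F (vecCoord Y e) c.equivX (fun i => (i : ℕ) < k)
      (fun i => (i : ℕ) < k) := by
  ext ⟨x, y⟩
  by_cases hx : x ∈ e.1.target
  swap
  · exact iff_of_false (fun h => hx h.1) fun h => hx h.1.1
  have hp := e.1.map_target hx
  have h1 : (x, y) ∈ xRead e (lagrangian V Y) ↔ _ :=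
    (and_iff_right hx).trans (mem_lagrangian_iff (V := V) (Y := Y) hp (tanVec e x y))
  rw [h1, c.mem_localBase_iff hx]
  refine and_congr Iff.rfl ?_
  simp only [c.mem_annihilator _ hp, tanCoord_tanVec e hx]
  exact exists_add_integral_iff c.mul_inv _ _

/-- Dual to the case of `L(V,Y)`: the fiber is the linear part itself instead of its annihilator, so
`ζᵀ` replaces `ξ`, the complementary indices become integral, and there is no translation. -/
theorem wRead_complexSub : wRead e (complexSub V) =
    fiberedSet e.1.target c.F (fun _ => 0) c.equivW (fun i => (i : ℕ) < k)
      (fun i => ¬ (i : ℕ) < k) := by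
  ext ⟨x, y⟩
  by_cases hx : x ∈ e.1.target
  swap
  · exact iff_of_false (fun h => hx h.1) fun h => hx h.1.1
  have hp := e.1.map_target hx
  have h1 : (x, y) ∈ wRead e (complexSub V) ↔ _ :=
    (and_iff_right hx).trans (mem_complexSub_iff (V := V) hp y)
  rw [h1, c.mem_localBase_iff hx]
  refine and_congr Iff.rfl ?_
  simp only [c.mem_direction _ hp]
  have h2 : c.ζᵀ * c.ξᵀ = 1 := by rw [← Matrix.transpose_mul, c.mul_inv, Matrix.transpose_one]
  have h3 := exists_add_integral_iff h2 (fun i => ¬ (i : ℕ) < k) y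
  simp only [equivW, matEquiv_apply, sub_zero]
  exact h3

end FlatChart

variable [IsTropicalManifold m B] {V : AffineSection K k}

theorem isSubmanifoldX_lagrangian (hk : k ≤ m) (hV : V.IsConstant) {Y : ∀ p : B, Tan m B p}
    (hY : IsSmoothAlong V Y) : IsSubmanifoldX m (lagrangian V Y) := by
  intro e z hz
  obtain ⟨c⟩ := hV.nonempty_flatChart e
  rw [c.xRead_lagrangian] at hz ⊢
  obtain ⟨O, φ, h1, h2, -⟩ := exists_isLocalParam_fiberedSet (isCoordModel_modelX hk)
    e.1.open_target c.contDiffOn_F (fun x hx => ⟨_, c.hasFDerivAt_F hx⟩)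
    (c.contDiffOn_vecCoord hY) hz
  exact ⟨O, φ, h1, h2⟩

theorem isComplexSubmanifold_complexSub (hk : k ≤ m) (hV : V.IsConstant) :
    IsComplexSubmanifold K k (complexSub V) := by
  intro e z hz
  obtain ⟨c⟩ := hV.nonempty_flatChart e
  have hw := c.wRead_complexSub
  rw [hw] at hz
  obtain ⟨O, φ, h1, h2, n, hn⟩ := exists_isLocalParam_fiberedSet (isCoordModel_modelW hk)
    e.1.open_target c.contDiffOn_F (fun x hx => ⟨_, c.hasFDerivAt_F hx⟩) contDiffOn_const hz
  refine ⟨O, φ, ⟨hw ▸ h1, ?_⟩, h2⟩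
  -- Along the parametrization `x̃` is affine in `Re u` and `ỹ` is affine in `Im u` with the same
  -- linear part `Xᵀ * inclMat hk`. Hence `z̃` is a complex affine function of `u`.
  have h3 : ∀ u ∈ O, zW K e (φ u) = fun i => (∑ l, ((c.Xᵀ * inclMat hk) i l : ℂ) * u l) +
      ((c.a i : ℂ) + Complex.I * ((c.Xᵀ *ᵥ n) i : ℂ)) := by
    intro u hu
    obtain ⟨h4, h5⟩ := hn u hu
    rw [FlatChart.F, modelW_apply] at h4
    dsimp only at h4
    rw [modelW_apply, sub_zero, matEquiv_apply] at h5
    dsimp only at h5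
    have h6 : legendre K e (φ u).1 = (c.Xᵀ * inclMat hk) *ᵥ rePart u + c.a := by
      rw [← sub_eq_iff_eq_add, ← Matrix.mulVec_mulVec, ← h4, Matrix.mulVec_mulVec,
        c.transpose_X_mul_Z, Matrix.one_mulVec]
    have h7 : (φ u).2 = (c.Xᵀ * inclMat hk) *ᵥ imPart u + c.Xᵀ *ᵥ n := by
      rw [← Matrix.mulVec_mulVec, ← Matrix.mulVec_add, ← h5, Matrix.mulVec_mulVec,
        c.transpose_X_mul_Z, Matrix.one_mulVec]
    ext i
    rw [zW, h6, h7]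
    generalize c.Xᵀ *ᵥ n = n'
    generalize c.Xᵀ * inclMat hk = A
    simp only [Pi.add_apply, Matrix.mulVec, dotProduct, Complex.ofReal_add, Complex.ofReal_sum,
      Complex.ofReal_mul, rePart, imPart]
    have h8 : ∑ l, (A i l : ℂ) * u l = ∑ l, (A i l : ℂ) * ((u l).re : ℂ) +
        Complex.I * ∑ l, (A i l : ℂ) * ((u l).im : ℂ) := by
      rw [Finset.mul_sum, ← Finset.sum_add_distrib]
      refine Finset.sum_congr rfl fun l _ => ?_
      conv_lhs => rw [← Complex.re_add_im (u l)]
      ring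
    rw [h8]
    ring
  refine DifferentiableOn.congr ?_ h3
  refine differentiableOn_pi.2 fun i => ?_
  fun_prop

end FlatChart

/-! ### The Kähler form and the curvature in coordinates -/

section Forms

variable {m : ℕ} {B : Type*} [TopologicalSpace B] [ChartedSpace (Rn m) B]
  {K : ConvexMultivalued m B} {k : ℕ}

/-- By symmetry of the Hessian, the `dx ∧ dx` and `dy ∧ dy` terms cancel and only the real form `∑
dx̃_i ∧ dy_i` survives. -/
theorem omegaX_eq (K : ConvexMultivalued m B) (e : TropChart m B) {z : Rn m × Rn m}
    (hz : z.1 ∈ e.1.target) (v w : Rn m × Rn m) :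
    omegaX K e z v w =
      (((hess K e z.1 *ᵥ v.1) ⬝ᵥ w.2 - (hess K e z.1 *ᵥ w.1) ⬝ᵥ v.2 : ℝ) : ℂ) := by
  set H := hess K e z.1
  have hs : ∀ u u' : Rn m, ∑ i, ∑ j, (H i j : ℂ) * ((u i : ℂ) * (u' j : ℂ)) =
      ((u ⬝ᵥ (H *ᵥ u') : ℝ) : ℂ) := fun u u' => by
    simp only [dotProduct, Matrix.mulVec, Complex.ofReal_sum, Complex.ofReal_mul, Finset.mul_sum]
    exact Finset.sum_congr rfl fun i _ => Finset.sum_congr rfl fun j _ => by ring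
  have hsymm : ∀ u u' : Rn m, u ⬝ᵥ (H *ᵥ u') = (H *ᵥ u) ⬝ᵥ u' := fun u u' => by
    rw [Matrix.dotProduct_mulVec, ← Matrix.mulVec_transpose, hess_transpose K e hz]
  have h1 : ∀ i j, (H i j : ℂ) * (dz v i * (starRingEnd ℂ) (dz w j) -
      dz w i * (starRingEnd ℂ) (dz v j)) =
      ((H i j : ℂ) * ((v.1 i : ℂ) * (w.1 j : ℂ)) - (H i j : ℂ) * ((w.1 i : ℂ) * (v.1 j : ℂ))) +
      ((H i j : ℂ) * ((v.2 i : ℂ) * (w.2 j : ℂ)) - (H i j : ℂ) * ((w.2 i : ℂ) * (v.2 j : ℂ))) +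
      Complex.I * (((H i j : ℂ) * ((v.2 i : ℂ) * (w.1 j : ℂ)) -
          (H i j : ℂ) * ((v.1 i : ℂ) * (w.2 j : ℂ))) -
        ((H i j : ℂ) * ((w.2 i : ℂ) * (v.1 j : ℂ)) -
          (H i j : ℂ) * ((w.1 i : ℂ) * (v.2 j : ℂ)))) := fun i j => by
    simp only [dz, map_add, map_mul, Complex.conj_I, Complex.conj_ofReal]
    linear_combination (H i j : ℂ) * ((w.2 i : ℂ) * (v.2 j : ℂ) - (v.2 i : ℂ) * (w.2 j : ℂ)) *
      Complex.I_sq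
  rw [omegaX]
  simp only [H] at h1 hs hsymm
  simp only [h1, Finset.sum_add_distrib, Finset.sum_sub_distrib, ← Finset.mul_sum, hs]
  rw [hsymm v.1 w.1, hsymm v.2 w.2, hsymm v.1 w.2, hsymm w.1 v.2,
    dotProduct_comm (_ *ᵥ v.1) w.1, dotProduct_comm (_ *ᵥ v.2) w.2,
    dotProduct_comm v.2, dotProduct_comm w.2 (_ *ᵥ v.1)]
  push_cast
  linear_combination ((((hess K e z.1 *ᵥ w.1) ⬝ᵥ v.2 : ℝ) : ℂ) -
    (((hess K e z.1 *ᵥ v.1) ⬝ᵥ w.2 : ℝ) : ℂ)) * Complex.I_sq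

theorem pullback_connForm_apply (Y : ∀ p : B, Tan m B p) (e : TropChart m B)
    (φ : (Fin k → ℂ) → Rn m × Rn m) (u w : Fin k → ℂ) :
    pullback (connForm Y e) φ u w =
      Complex.I * ((∑ j, vecCoord Y e (φ u).1 j * (fderiv ℝ φ u w).2 j : ℝ) : ℂ) := by
  simp [pullback, connForm, Finset.mul_sum, mul_assoc]

/-- The pulled back form is `√-1 ∑ Y_j d(ỹ_j ∘ φ)`, so its differential is `√-1 ∑ dY_j ∧ dỹ_j`: the
second derivatives of `φ` cancel by symmetry. Differentiability is assumed for the composite with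
`φ` because `Y` is smooth only along `B(V)`. -/
theorem curvature_pullback_connForm {Y : ∀ p : B, Tan m B p} {e : TropChart m B}
    {φ : (Fin k → ℂ) → Rn m × Rn m} {u : Fin k → ℂ} (hφ : ContDiffAt ℝ 2 φ u)
    {L : (Fin k → ℂ) →L[ℝ] Rn m} (hL : HasFDerivAt (fun u => vecCoord Y e (φ u).1) L u)
    (v w : Fin k → ℂ) :
    curvature (pullback (connForm Y e) φ) u v w = Complex.I *
      ((L v ⬝ᵥ (fderiv ℝ φ u w).2 - L w ⬝ᵥ (fderiv ℝ φ u v).2 : ℝ) : ℂ) := by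
  have hφ' : DifferentiableAt ℝ (fderiv ℝ φ) u :=
    (hφ.fderiv_right (m := 1) (by norm_num)).differentiableAt (by simp)
  have hsymm : IsSymmSndFDerivAt ℝ φ u := hφ.isSymmSndFDerivAt (by simp)
  have hg : ∀ w, HasFDerivAt (fun u => pullback (connForm Y e) φ u w)
      (Complex.I • Complex.ofRealCLM.comp (∑ j, (vecCoord Y e (φ u).1 j •
        ((ContinuousLinearMap.proj (R := ℝ) (φ := fun _ : Fin m => ℝ) j).comp
          ((ContinuousLinearMap.snd ℝ _ _).comp ((fderiv ℝ (fderiv ℝ φ) u).flip w))) +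
        (fderiv ℝ φ u w).2 j •
          (ContinuousLinearMap.proj (R := ℝ) (φ := fun _ : Fin m => ℝ) j).comp L))) u := by
    intro w
    simp only [pullback_connForm_apply]
    have h1 : HasFDerivAt (fun u => (fderiv ℝ φ u w).2)
        ((ContinuousLinearMap.snd ℝ _ _).comp ((fderiv ℝ (fderiv ℝ φ) u).flip w)) u := by
      have := hφ'.hasFDerivAt.clm_apply (hasFDerivAt_const w u)
      simpa using this.snd
    have h2 := HasFDerivAt.fun_sum (u := Finset.univ) fun j _ =>
      (hasFDerivAt_pi'.1 hL j).mul (hasFDerivAt_pi'.1 h1 j)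
    exact (Complex.ofRealCLM.hasFDerivAt.comp u h2).const_mul Complex.I
  have hd : DifferentiableAt ℝ (fun u' => toForm (pullback (connForm Y e) φ u')) u := by
    have h1 : DifferentiableAt ℝ (fun u' => pullback (connForm Y e) φ u') u := by
      refine DifferentiableAt.clm_comp ?_ hφ'
      refine DifferentiableAt.fun_sum fun j _ => DifferentiableAt.smul_const ?_ _
      exact (Complex.ofRealCLM.differentiableAt.comp u
        (hasFDerivAt_pi'.1 hL j).differentiableAt).const_mul _
    exact (ContinuousAlternatingMap.ofSubsingletonLIE (𝕜 := ℝ) (E := Fin k → ℂ) (F := ℂ)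
      (0 : Fin 1)).differentiable.differentiableAt.comp u h1
  have h0 : ∀ w, (fun u' => toForm (pullback (connForm Y e) φ u') ![w]) =
      fun u' => pullback (connForm Y e) φ u' w := fun w => rfl
  have e0 : (0 : Fin 2).removeNth ![v, w] = ![w] := by ext i; fin_cases i; rfl
  have e1 : (1 : Fin 2).removeNth ![v, w] = ![v] := by ext i; fin_cases i; rfl
  rw [curvature, extDeriv_apply hd, Fin.sum_univ_two, e0, e1, h0, h0, (hg w).fderiv, (hg v).fderiv]
  have h2 := hsymm v w
  simp [dotProduct, Finset.sum_add_distrib, h2]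
  ring_nf
  simp only [mul_comm]

end Forms

/-! ### Symmetric matrices and a block determinant -/

section Algebra

variable {m k : ℕ}

theorem transpose_eq_self_iff {n : Type*} [Fintype n] [DecidableEq n] (N : Matrix n n ℝ) :
    Nᵀ = N ↔ ∀ f g : n → ℝ, f ⬝ᵥ (N *ᵥ g) = g ⬝ᵥ (N *ᵥ f) := by
  constructor
  · intro h f g
    conv_lhs => rw [← h, Matrix.mulVec_transpose, dotProduct_comm, ← Matrix.dotProduct_mulVec]
  · intro h
    ext i j
    have := h (Pi.single j 1) (Pi.single i 1)
    simpa using this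

theorem im_mul_ofReal_eq_zero_iff {z : ℂ} {r : ℝ} (hr : r ≠ 0) :
    (z * (r : ℂ)).im = 0 ↔ z.im = 0 := by
  rw [Complex.im_mul_ofReal, mul_eq_zero, or_iff_left hr]

theorem inclMat_dotProduct_mulVec (hk : k ≤ m) (A : Matrix (Fin m) (Fin m) ℝ) (f g : Fin k → ℝ) :
    (inclMat hk *ᵥ f) ⬝ᵥ (A *ᵥ (inclMat hk *ᵥ g)) =
      f ⬝ᵥ (((inclMat hk)ᵀ * A * inclMat hk) *ᵥ g) := by
  rw [← Matrix.mulVec_mulVec, ← Matrix.mulVec_mulVec, Matrix.dotProduct_mulVec f,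
    Matrix.vecMul_transpose]

theorem transpose_mulVec_dotProduct {n n' : Type*} [Fintype n] [Fintype n'] (A : Matrix n n' ℝ)
    (s : n → ℝ) (b : n' → ℝ) : (Aᵀ *ᵥ s) ⬝ᵥ b = s ⬝ᵥ (A *ᵥ b) := by
  rw [Matrix.mulVec_transpose, Matrix.dotProduct_mulVec]

theorem inclMat_transpose_mul_mul_apply (hk : k ≤ m) (A : Matrix (Fin m) (Fin m) ℝ) (l l' : Fin k) :
    ((inclMat hk)ᵀ * A * inclMat hk) l l' = A (Fin.castLE hk l) (Fin.castLE hk l') := by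
  simp [Matrix.mul_apply, inclMat]

/-- The determinant of the matrix with the columns of `A` in the first `k` places and those of
`√-1` times the identity in the other places. -/
theorem det_ite_eq (hk : k ≤ m) (A : Matrix (Fin m) (Fin m) ℂ) :
    (Matrix.of fun i j : Fin m => if (j : ℕ) < k then A i j else if i = j then Complex.I else 0).det =
      (A.submatrix (Fin.castLE hk) (Fin.castLE hk)).det * Complex.I ^ (m - k) := by
  classical
  rw [Matrix.twoBlockTriangular_det' _ (fun i : Fin m => (i : ℕ) < k)]
  swap
  · intro i hi j hj
    rw [Matrix.of_apply, if_neg hj, if_neg (by rintro rfl; exact hj hi)]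
  congr 1
  · let e : Fin k ≃ {i : Fin m // (i : ℕ) < k} :=
      { toFun := fun l => ⟨Fin.castLE hk l, l.2⟩
        invFun := fun i => ⟨i.1, i.2⟩
        left_inv := fun _ => rfl
        right_inv := fun _ => rfl }
    rw [← Matrix.det_submatrix_equiv_self e]
    congr 1
    ext l l'
    simp [Matrix.toSquareBlockProp, e]
  · have h1 : (Matrix.of fun i j : Fin m => if (j : ℕ) < k then A i j else
        if i = j then Complex.I else 0).toSquareBlockProp (fun i => ¬ (i : ℕ) < k) =
        Complex.I • (1 : Matrix {i : Fin m // ¬ (i : ℕ) < k} {i : Fin m // ¬ (i : ℕ) < k} ℂ) := by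
      ext i j
      change (if ((j : Fin m) : ℕ) < k then A i j else if (i : Fin m) = j then Complex.I else 0) = _
      rw [if_neg j.2, Matrix.smul_apply, Matrix.one_apply, smul_eq_mul, mul_ite, mul_one, mul_zero]
      simp only [Subtype.ext_iff]
    rw [h1, Matrix.det_smul, Matrix.det_one, mul_one, Fintype.card_subtype_compl]
    congr 2
    · simp
    · rw [Fintype.card_subtype]
      have : (Finset.univ.filter fun i : Fin m => (i : ℕ) < k) = Finset.univ.map (Fin.castLEEmb hk) := by
        ext i
        simp only [Finset.mem_filter, Finset.mem_univ, true_and, Finset.mem_map]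
        exact ⟨fun h => ⟨⟨i, h⟩, rfl⟩, by rintro ⟨l, rfl⟩; exact l.2⟩
      rw [this, Finset.card_map, Finset.card_univ, Fintype.card_fin]

end Algebra

/-! ### The Lagrangian side: tangent vectors, `ω` and `Ω` -/

namespace FlatChart

variable {m : ℕ} {B : Type*} [TopologicalSpace B] [ChartedSpace (Rn m) B]
  {K : ConvexMultivalued m B} {k : ℕ} {V : AffineSection K k} {e : TropChart m B}
  (c : FlatChart V e) (Y : ∀ p : B, Tan m B p) (hk : k ≤ m) (x : Rn m)

/-- The derivative of `Y` along `B(V)`. -/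
noncomputable def Y' : Rn m →L[ℝ] Rn m := fderivWithin ℝ (vecCoord Y e) c.slice x

/-- The inverse Hessian in integral coordinates. -/
noncomputable def G : Matrix (Fin m) (Fin m) ℝ := c.X * ((hess K e x)⁻¹ * c.Xᵀ)

/-- The derivative of `Y` with respect to the `x̃` in integral coordinates. -/
noncomputable def N : Matrix (Fin m) (Fin m) ℝ :=
  c.X * (LinearMap.toMatrix' (c.Y' Y x : Rn m →ₗ[ℝ] Rn m) * ((hess K e x)⁻¹ * c.Xᵀ))

/-- The inverse Hessian along the linear part of `V`. -/
noncomputable def Gk : Matrix (Fin k) (Fin k) ℝ := (inclMat hk)ᵀ * c.G x * inclMat hk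

/-- The derivative of `Y` along the linear part of `V`. -/
noncomputable def Nk : Matrix (Fin k) (Fin k) ℝ := (inclMat hk)ᵀ * c.N Y x * inclMat hk

/-- The matrix of `ω̃ + F`, whose determinant is the phase function of `L(V,Y)` and of `D^Y`. -/
noncomputable def phaseMat : Matrix (Fin k) (Fin k) ℂ :=
  Matrix.of fun i j => (c.Gk hk x i j : ℂ) + Complex.I * (c.Nk Y hk x i j : ℂ)

variable {x}

/-- Solving `H a = Xᵀ s` for `a` expresses all base components through `s`. For `s` supported in the
first `k` places, `a` is tangent to the slice; these are the only directions in which `Y'` is used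
in `Nk`. -/
theorem of_F'_eq (hx : x ∈ e.1.target) {a s : Rn m} (h : c.F' hx a = s) :
    hess K e x *ᵥ a = c.Xᵀ *ᵥ s ∧ c.X *ᵥ a = c.G x *ᵥ s ∧ c.X *ᵥ (c.Y' Y x a) = c.N Y x *ᵥ s := by
  have h1 : hess K e x *ᵥ a = c.Xᵀ *ᵥ s := by
    rw [← h, c.F'_apply, Matrix.mulVec_mulVec, c.transpose_X_mul_Z, Matrix.one_mulVec]
  have h2 : a = ((hess K e x)⁻¹ * c.Xᵀ) *ᵥ s := by
    rw [← Matrix.mulVec_mulVec, ← h1, Matrix.mulVec_mulVec, inv_mul_hess hx, Matrix.one_mulVec]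
  refine ⟨h1, ?_, ?_⟩
  · rw [G, ← Matrix.mulVec_mulVec, ← h2]
  · rw [N, ← Matrix.mulVec_mulVec, ← Matrix.mulVec_mulVec, ← h2, LinearMap.toMatrix'_mulVec]
    rfl

variable {Y} [IsTropicalManifold m B]

section Lagrangian

variable {O : Set (Rn m)} {φ : Rn m → Rn m × Rn m} {u : Rn m}

theorem tangent_lagrangian (hY : IsSmoothAlong V Y)
    (hφ : IsLocalParam (xRead e (lagrangian V Y)) O φ) (hu : u ∈ O) :
    ∃ M : Rn m ≃ₗ[ℝ] Rn m, ∀ v,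
      hess K e (φ u).1 *ᵥ (fderiv ℝ φ u v).1 =
        c.Xᵀ *ᵥ (inclMat hk *ᵥ ((inclMat hk)ᵀ *ᵥ M v)) ∧
      c.X *ᵥ (fderiv ℝ φ u v).1 = c.G (φ u).1 *ᵥ (inclMat hk *ᵥ ((inclMat hk)ᵀ *ᵥ M v)) ∧
      c.X *ᵥ (fderiv ℝ φ u v).2 = c.N Y (φ u).1 *ᵥ (inclMat hk *ᵥ ((inclMat hk)ᵀ *ᵥ M v)) +
        (M v - inclMat hk *ᵥ ((inclMat hk)ᵀ *ᵥ M v)) := by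
  rw [c.xRead_lagrangian] at hφ
  have hx : (φ u).1 ∈ e.1.target := (hφ.mapsTo hu).1.1
  obtain ⟨M, hM⟩ := hφ.exists_equiv (isCoordModel_modelX hk) (c.contDiffOn_vecCoord hY) hu
    (c.hasFDerivAt_F hx)
  refine ⟨M, fun v => ?_⟩
  obtain ⟨h1, h2⟩ := hM v
  rw [modelX_apply] at h1 h2
  obtain ⟨h3, h4, h5⟩ := c.of_F'_eq Y hx h1
  refine ⟨h3, h4, ?_⟩
  change c.X *ᵥ ((fderiv ℝ φ u v).2 - c.Y' Y (φ u).1 (fderiv ℝ φ u v).1) = _ at h2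
  rw [Matrix.mulVec_sub, h5, sub_eq_iff_eq_add'] at h2
  exact h2

/-- In `ω = ∑ dx̃_i ∧ dy_i` the vertical part of one vector pairs to zero with the `x̃`-part of the
other, their supports in integral coordinates being complementary. What remains is the antisymmetric
part of `Nk`, and `M` being onto makes all pairs of arguments occur. -/
theorem omegaX_eq_zero_iff (hY : IsSmoothAlong V Y)
    (hφ : IsLocalParam (xRead e (lagrangian V Y)) O φ) (hu : u ∈ O) :
    (∀ a b : Rn m, omegaX K e (φ u) (fderiv ℝ φ u a) (fderiv ℝ φ u b) = 0) ↔
      (c.Nk Y hk (φ u).1)ᵀ = c.Nk Y hk (φ u).1 := by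
  obtain ⟨M, hM⟩ := c.tangent_lagrangian hk hY hφ hu
  have key : ∀ a b, (hess K e (φ u).1 *ᵥ (fderiv ℝ φ u a).1) ⬝ᵥ (fderiv ℝ φ u b).2 =
      ((inclMat hk)ᵀ *ᵥ M a) ⬝ᵥ (c.Nk Y hk (φ u).1 *ᵥ ((inclMat hk)ᵀ *ᵥ M b)) := fun a b => by
    rw [(hM a).1, transpose_mulVec_dotProduct, (hM b).2.2, dotProduct_add,
      inclMat_dotProduct_mulVec, Nk, add_eq_left]
    have h := transpose_mulVec_dotProduct (inclMat hk)ᵀ ((inclMat hk)ᵀ *ᵥ M a)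
      (M b - inclMat hk *ᵥ ((inclMat hk)ᵀ *ᵥ M b))
    rwa [Matrix.transpose_transpose, Matrix.mulVec_sub, inclMat_transpose_mulVec_mulVec, sub_self,
      dotProduct_zero] at h
  have hx : (φ u).1 ∈ e.1.target := (hφ.mapsTo hu).1
  simp only [omegaX_eq K e hx, key, Complex.ofReal_eq_zero, sub_eq_zero]
  rw [transpose_eq_self_iff]
  constructor
  · intro h f g
    have := h (M.symm (inclMat hk *ᵥ f)) (M.symm (inclMat hk *ᵥ g))
    simpa only [LinearEquiv.apply_symm_apply, inclMat_transpose_mulVec_mulVec] using this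
  · exact fun h a b => h _ _

/-- Multiplication by `X` writes the matrix of the `dz_i` as `Q` times a real matrix, where `Q` has
determinant `(√-1)^(m-k) det (Gk + √-1 Nk)`. Real determinants do not affect the vanishing of the
imaginary part as long as they are nonzero. -/
theorem im_OmegaX_eq_zero_iff (hY : IsSmoothAlong V Y)
    (hφ : IsLocalParam (xRead e (lagrangian V Y)) O φ) (hu : u ∈ O) (t : ℂ) :
    (∀ a : Fin m → Rn m, (t * OmegaX (fun j => fderiv ℝ φ u (a j))).im = 0) ↔
      (t * Complex.I ^ (m - k) * (c.phaseMat Y hk (φ u).1).det).im = 0 := by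
  obtain ⟨M, hM⟩ := c.tangent_lagrangian hk hY hφ hu
  set x := (φ u).1
  let A : Matrix (Fin m) (Fin m) ℂ :=
    Matrix.of fun i j => (c.G x i j : ℂ) + Complex.I * (c.N Y x i j : ℂ)
  let Q : Matrix (Fin m) (Fin m) ℂ :=
    Matrix.of fun i j : Fin m => if (j : ℕ) < k then A i j else if i = j then Complex.I else 0
  have hd : c.X.det ≠ 0 := fun h => by
    have := congrArg Matrix.det c.X_mul_Z
    rw [Matrix.det_mul, h, zero_mul, Matrix.det_one] at this
    exact zero_ne_one this
  have hA : A.submatrix (Fin.castLE hk) (Fin.castLE hk) = c.phaseMat Y hk x := by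
    ext l l'
    simp [A, phaseMat, Gk, Nk, inclMat_transpose_mul_mul_apply]
  have hQ : Q.det = (c.phaseMat Y hk x).det * Complex.I ^ (m - k) := by
    rw [det_ite_eq hk A, hA]
  have key : ∀ a : Fin m → Rn m, OmegaX (fun j => fderiv ℝ φ u (a j)) * (c.X.det : ℂ) =
      Q.det * ((Matrix.of fun i j : Fin m => M (a j) i).det : ℂ) := fun a => by
    have h1 : c.X.map Complex.ofRealHom *
        (Matrix.of fun i j : Fin m => dz (fderiv ℝ φ u (a j)) i) =
        Q * (Matrix.of fun i j : Fin m => M (a j) i).map Complex.ofRealHom := by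
      ext i j
      obtain ⟨-, h2, h3⟩ := hM (a j)
      have h4 : (c.X.map Complex.ofRealHom *
          (Matrix.of fun i j : Fin m => dz (fderiv ℝ φ u (a j)) i)) i j =
          (((c.X *ᵥ (fderiv ℝ φ u (a j)).1) i : ℝ) : ℂ) +
            Complex.I * (((c.X *ᵥ (fderiv ℝ φ u (a j)).2) i : ℝ) : ℂ) := by
        simp only [Matrix.mul_apply, Matrix.mulVec, dotProduct, Complex.ofReal_sum,
          Complex.ofReal_mul, Finset.mul_sum, ← Finset.sum_add_distrib, dz]
        refine Finset.sum_congr rfl fun l _ => ?_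
        simp only [Matrix.map_apply, Matrix.of_apply, Complex.ofRealHom_eq_coe]
        ring
      rw [h4, h2, h3]
      -- `s` keeps the first `k` entries of `M (a j)` and meets the columns of `G + √-1 N`; `M (a j)
      -- - s` keeps the others and meets the columns of `√-1` times the identity.
      set s := inclMat hk *ᵥ ((inclMat hk)ᵀ *ᵥ M (a j)) with hs
      have hs' : ∀ l, s l = if (l : ℕ) < k then M (a j) l else 0 :=
        inclMat_mulVec_transpose_mulVec hk _
      have h5 : (((M (a j) - s) i : ℝ) : ℂ) =
          ∑ l, if i = l then (((M (a j) - s) l : ℝ) : ℂ) else 0 := by simp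
      rw [Pi.add_apply, Complex.ofReal_add, h5]
      simp only [Matrix.mul_apply, Matrix.mulVec, dotProduct, Complex.ofReal_sum,
        Complex.ofReal_mul, Finset.mul_sum, ← Finset.sum_add_distrib]
      refine Finset.sum_congr rfl fun l _ => ?_
      simp only [Q, A, Matrix.map_apply, Matrix.of_apply, Complex.ofRealHom_eq_coe, Pi.sub_apply,
        hs']
      split_ifs
      · simp; ring
      · simp; ring
      · simp
      · simp
    have h6 := congrArg Matrix.det h1
    rw [Matrix.det_mul, Matrix.det_mul] at h6
    rw [← Complex.ofRealHom_eq_coe, ← Complex.ofRealHom_eq_coe, RingHom.map_det, RingHom.map_det,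
      mul_comm]
    exact h6
  have key2 : ∀ a : Fin m → Rn m, (t * OmegaX (fun j => fderiv ℝ φ u (a j))).im = 0 ↔
      (t * Complex.I ^ (m - k) * (c.phaseMat Y hk x).det *
        ((Matrix.of fun i j : Fin m => M (a j) i).det : ℂ)).im = 0 := fun a => by
    rw [← im_mul_ofReal_eq_zero_iff hd, mul_assoc, key, hQ]
    ring_nf
  constructor
  · intro h
    -- The tangent vectors corresponding to the standard basis under `M` make the real determinant
    -- equal to `1`.
    have h1 := (key2 fun j => M.symm (Pi.single j 1)).1 (h _)
    have h2 : (Matrix.of fun i j : Fin m => M (M.symm (Pi.single j 1)) i) =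
        (1 : Matrix (Fin m) (Fin m) ℝ) := by
      ext i j
      simp [Pi.single_apply, Matrix.one_apply]
    rwa [h2, Matrix.det_one, Complex.ofReal_one, mul_one] at h1
  · intro h a
    rw [key2, Complex.im_mul_ofReal, h, zero_mul]

end Lagrangian

end FlatChart

/-! ### The complex side: tangent vectors, curvature and the top power -/

namespace FlatChart

variable {m : ℕ} {B : Type*} [TopologicalSpace B] [ChartedSpace (Rn m) B]
  {K : ConvexMultivalued m B} {k : ℕ} {V : AffineSection K k} {e : TropChart m B}
  (c : FlatChart V e) {Y : ∀ p : B, Tan m B p} (hk : k ≤ m)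
  {O : Set (Fin k → ℂ)} {φ : (Fin k → ℂ) → Rn m × Rn m} {u : Fin k → ℂ}

theorem transpose_X_inclMat_injective {f g : Fin k → ℝ}
    (h : c.Xᵀ *ᵥ (inclMat hk *ᵥ f) = c.Xᵀ *ᵥ (inclMat hk *ᵥ g)) : f = g := by
  have h1 := congrArg (fun v => (inclMat hk)ᵀ *ᵥ (c.Zᵀ *ᵥ v)) h
  simpa only [Matrix.mulVec_mulVec c.Xᵀ, Matrix.mulVec_mulVec _ c.Zᵀ c.Xᵀ, c.transpose_Z_mul_X,
    Matrix.one_mulVec, inclMat_transpose_mulVec_mulVec] using h1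

variable [IsTropicalManifold m B]

/-- The automorphism `M` of the model is complex linear because `z̃ ∘ φ` is holomorphic and its
derivative at `v` is the injective complex linear map `Xᵀ * inclMat hk` applied to `M v`. This makes
the `(0,2)`-part computable in the coordinates of the model. -/
theorem tangent_complexSub (hφ : IsHolParam K (complexSub V) e O φ) (hu : u ∈ O) :
    ∃ M : (Fin k → ℂ) ≃ₗ[ℝ] (Fin k → ℂ), (∀ v, M (Complex.I • v) = Complex.I • M v) ∧ ∀ v,
      c.X *ᵥ (fderiv ℝ φ u v).1 = c.G (φ u).1 *ᵥ (inclMat hk *ᵥ rePart (M v)) ∧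
      (fderiv ℝ φ u v).2 = c.Xᵀ *ᵥ (inclMat hk *ᵥ imPart (M v)) ∧
      ∀ Y : ∀ p : B, Tan m B p, c.X *ᵥ (c.Y' Y (φ u).1 (fderiv ℝ φ u v).1) =
        c.N Y (φ u).1 *ᵥ (inclMat hk *ᵥ rePart (M v)) := by
  obtain ⟨hφ, hhol⟩ := hφ
  rw [c.wRead_complexSub] at hφ
  have hx : (φ u).1 ∈ e.1.target := (hφ.mapsTo hu).1.1
  obtain ⟨M, hM⟩ := hφ.exists_equiv (isCoordModel_modelW hk) contDiffOn_const hu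
    (c.hasFDerivAt_F hx)
  simp only [modelW_apply, fderivWithin_fun_const, matEquiv_apply] at hM
  have hM2 : ∀ v, (fderiv ℝ φ u v).2 = c.Xᵀ *ᵥ (inclMat hk *ᵥ imPart (M v)) := fun v => by
    have h1 : c.Zᵀ *ᵥ ((fderiv ℝ φ u v).2 - 0) = inclMat hk *ᵥ imPart (M v) := (hM v).2
    rw [← h1, Matrix.mulVec_mulVec, c.transpose_X_mul_Z, Matrix.one_mulVec, sub_zero]
  -- The first two conclusions do not involve the section, so the zero section serves.
  have hM1 := fun v => c.of_F'_eq (fun p => (0 : Tan m B p)) hx (hM v).1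
  refine ⟨M, fun v => ?_, fun v => ⟨(hM1 v).2.1, hM2 v, fun Y => (c.of_F'_eq Y hx (hM v).1).2.2⟩⟩
  have hOu := hφ.isOpen.mem_nhds hu
  have h1 : HasFDerivAt φ (fderiv ℝ φ u) u :=
    ((hφ.smooth.contDiffAt hOu).differentiableAt (by simp)).hasFDerivAt
  have h2 := (hhol.differentiableAt hOu).hasFDerivAt
  set T := fderiv ℂ (fun u => zW K e (φ u)) u
  have h11 : HasFDerivAt (fun u => (φ u).1) _ u := h1.fst
  have h12 : HasFDerivAt (fun u => (φ u).2) _ u := h1.snd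
  have hleg := HasFDerivAt.comp u (hasFDerivAt_legendre K e hx) h11
  have hT : ∀ v i, T v i = (((hess K e (φ u).1 *ᵥ (fderiv ℝ φ u v).1) i : ℝ) : ℂ) +
      Complex.I * (((fderiv ℝ φ u v).2 i : ℝ) : ℂ) := fun v i => by
    have h3 := hasFDerivAt_pi'.1 (h2.restrictScalars ℝ) i
    have h4 := (Complex.ofRealCLM.hasFDerivAt.comp u (hasFDerivAt_pi'.1 hleg i)).add
      ((Complex.ofRealCLM.hasFDerivAt.comp u (hasFDerivAt_pi'.1 h12 i)).const_mul Complex.I)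
    exact DFunLike.congr_fun (h3.unique h4) v
  have hI : ∀ i, T (Complex.I • v) i = Complex.I * T v i := fun i => by
    rw [map_smul, Pi.smul_apply, smul_eq_mul]
  -- Real and imaginary parts of `T (√-1 v) = √-1 T v` now compare `M (√-1 v)` with `√-1 M v`.
  simp only [hT, (hM1 _).1, hM2] at hI
  have hre : rePart (M (Complex.I • v)) = - imPart (M v) := by
    refine c.transpose_X_inclMat_injective hk ?_
    ext i
    have := congrArg Complex.re (hI i)
    simpa [Matrix.mulVec_neg, -Matrix.mulVec_mulVec] using this
  have him : imPart (M (Complex.I • v)) = rePart (M v) := by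
    refine c.transpose_X_inclMat_injective hk ?_
    ext i
    have := congrArg Complex.im (hI i)
    simpa [-Matrix.mulVec_mulVec] using this
  ext l
  refine Complex.ext ?_ ?_
  · have := congrFun hre l
    simpa [rePart, imPart] using this
  · have := congrFun him l
    simpa [rePart, imPart] using this

theorem exists_curvature_eq (hY : IsSmoothAlong V Y) (hφ : IsHolParam K (complexSub V) e O φ)
    (hu : u ∈ O) :
    ∃ M : (Fin k → ℂ) ≃ₗ[ℝ] (Fin k → ℂ), (∀ v, M (Complex.I • v) = Complex.I • M v) ∧
      (∀ v w, curvature (pullback (connForm Y e) φ) u v w = Complex.I *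
        ((imPart (M w) ⬝ᵥ (c.Nk Y hk (φ u).1 *ᵥ rePart (M v)) -
          imPart (M v) ⬝ᵥ (c.Nk Y hk (φ u).1 *ᵥ rePart (M w)) : ℝ) : ℂ)) ∧
      ∀ v w, omegaW (fderiv ℝ φ u v) (fderiv ℝ φ u w) =
        imPart (M w) ⬝ᵥ (c.Gk hk (φ u).1 *ᵥ rePart (M v)) -
          imPart (M v) ⬝ᵥ (c.Gk hk (φ u).1 *ᵥ rePart (M w)) := by
  obtain ⟨M, hI, hM⟩ := c.tangent_complexSub hk hφ hu
  have hOu := hφ.1.isOpen.mem_nhds hu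
  have hφu := hφ.1.smooth.contDiffAt hOu
  have h1 : HasFDerivAt φ (fderiv ℝ φ u) u := (hφu.differentiableAt (by simp)).hasFDerivAt
  have h11 : HasFDerivAt (fun u => (φ u).1) _ u := h1.fst
  have hw := hφ.1.mapsTo
  rw [c.wRead_complexSub] at hw
  have hYw : HasFDerivWithinAt (vecCoord Y e) (c.Y' Y (φ u).1) c.slice (φ u).1 :=
    ((c.contDiffOn_vecCoord hY _ (hw hu).1).differentiableWithinAt (by simp)).hasFDerivWithinAt
  have hL := hYw.comp_hasFDerivAt u h11
    (by filter_upwards [hOu] with v hv using (hw hv).1)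
  refine ⟨M, hI, fun v w => ?_, fun v w => ?_⟩
  · have key : ∀ v w, (c.Y' Y (φ u).1 (fderiv ℝ φ u v).1) ⬝ᵥ (fderiv ℝ φ u w).2 =
        imPart (M w) ⬝ᵥ (c.Nk Y hk (φ u).1 *ᵥ rePart (M v)) := fun v w => by
      rw [(hM w).2.1, dotProduct_comm, transpose_mulVec_dotProduct, (hM v).2.2 Y,
        inclMat_dotProduct_mulVec, Nk]
    rw [curvature_pullback_connForm (mod_cast contDiffAt_infty.1 hφu 2) hL, ← key, ← key]
    rfl
  · have key : ∀ v w, (fderiv ℝ φ u v).1 ⬝ᵥ (fderiv ℝ φ u w).2 =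
        imPart (M w) ⬝ᵥ (c.Gk hk (φ u).1 *ᵥ rePart (M v)) := fun v w => by
      rw [(hM w).2.1, dotProduct_comm, transpose_mulVec_dotProduct, (hM v).1,
        inclMat_dotProduct_mulVec, Gk]
    rw [← key, ← key, omegaW, Finset.sum_sub_distrib]
    rfl

theorem rePart_I_smul (v : Fin k → ℂ) : rePart (Complex.I • v) = - imPart v := by
  ext l
  simp [rePart, imPart]

theorem imPart_I_smul (v : Fin k → ℂ) : imPart (Complex.I • v) = rePart v := by
  ext l
  simp [rePart, imPart]

/-- The curvature is `√-1` times a real form pairing real with imaginary parts through `Nk`; the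
`(0,2)`-part antisymmetrizes this pairing. -/
theorem part02_curvature_eq_zero_iff (hY : IsSmoothAlong V Y)
    (hφ : IsHolParam K (complexSub V) e O φ) (hu : u ∈ O) :
    (∀ a b, part02 (curvature (pullback (connForm Y e) φ) u) a b = 0) ↔
      (c.Nk Y hk (φ u).1)ᵀ = c.Nk Y hk (φ u).1 := by
  obtain ⟨M, hI, hM, -⟩ := c.exists_curvature_eq hk hY hφ hu
  simp only [part02, hM, hI, rePart_I_smul, imPart_I_smul]
  rw [transpose_eq_self_iff]
  constructor
  · intro h f g
    -- For a real and a purely imaginary argument the two middle terms of `part02` vanish, and the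
    -- outer ones leave a multiple of `f ⬝ᵥ (Nk *ᵥ g) - g ⬝ᵥ (Nk *ᵥ f)`.
    have h1 := h (M.symm fun l => (g l : ℂ)) (M.symm fun l => Complex.I * (f l : ℂ))
    simp only [LinearEquiv.apply_symm_apply] at h1
    have e1 : rePart (fun l => (g l : ℂ)) = g := by ext l; simp [rePart]
    have e2 : imPart (fun l => (g l : ℂ)) = 0 := by ext l; simp [imPart]
    have e3 : rePart (fun l => Complex.I * (f l : ℂ)) = 0 := by ext l; simp [rePart]
    have e4 : imPart (fun l => Complex.I * (f l : ℂ)) = f := by ext l; simp [imPart]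
    rw [e1, e2, e3, e4] at h1
    have h2 := congrArg Complex.im h1
    simp [Matrix.mulVec_neg] at h2
    linarith
  · intro h a b
    simp only [Matrix.mulVec_neg, dotProduct_neg]
    rw [h (imPart (M b)) (rePart (M a)), h (imPart (M a)) (rePart (M b)),
      h (rePart (M b)) (rePart (M a)), h (imPart (M b)) (imPart (M a))]
    push_cast
    ring

theorem im_wedgePow_eq_zero_iff (hY : IsSmoothAlong V Y)
    (hφ : IsHolParam K (complexSub V) e O φ) (hu : u ∈ O) (t : ℂ) :
    (∀ v : Fin k × Fin 2 → (Fin k → ℂ), (t * wedgePow k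
        (fun a b => (omegaW (fderiv ℝ φ u a) (fderiv ℝ φ u b) : ℂ)
          + curvature (pullback (connForm Y e) φ) u a b) v).im = 0) ↔
      (t * (c.phaseMat Y hk (φ u).1).det).im = 0 := by
  obtain ⟨M, -, hM, hM'⟩ := c.exists_curvature_eq hk hY hφ hu
  obtain ⟨r, hr, hwedge⟩ := exists_wedgePow_pairForm k
  -- The `2k` real coordinates of `M v`, real parts at `(i, 0)` and imaginary parts at `(i, 1)`, as
  -- `pairForm` expects.
  let κ : (Fin k → ℂ) → Fin k × Fin 2 → ℝ := fun v s => ![rePart (M v) s.1, imPart (M v) s.1] s.2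
  have hβ : ∀ a b, (omegaW (fderiv ℝ φ u a) (fderiv ℝ φ u b) : ℂ) +
      curvature (pullback (connForm Y e) φ) u a b =
      pairForm (c.phaseMat Y hk (φ u).1)ᵀ (fun s => (κ a s : ℂ)) (fun s => (κ b s : ℂ)) := by
    intro a b
    rw [hM, hM']
    simp only [pairForm, κ, phaseMat, dotProduct, Matrix.mulVec, Finset.mul_sum,
      Complex.ofReal_sub, Complex.ofReal_sum, Complex.ofReal_mul, Matrix.transpose_apply,
      Matrix.of_apply, Matrix.cons_val_zero, Matrix.cons_val_one, mul_sub,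
      ← Finset.sum_sub_distrib, ← Finset.sum_add_distrib]
    rw [Finset.sum_comm]
    exact Finset.sum_congr rfl fun i _ => Finset.sum_congr rfl fun j _ => by ring
  have key : ∀ v : Fin k × Fin 2 → (Fin k → ℂ), (t * wedgePow k
      (fun a b => (omegaW (fderiv ℝ φ u a) (fderiv ℝ φ u b) : ℂ)
        + curvature (pullback (connForm Y e) φ) u a b) v).im = 0 ↔
      (t * (c.phaseMat Y hk (φ u).1).det * ((Matrix.of fun s => κ (v s)).det : ℂ)).im = 0 := by
    intro v
    have h1 : wedgePow k (fun a b => (omegaW (fderiv ℝ φ u a) (fderiv ℝ φ u b) : ℂ)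
        + curvature (pullback (connForm Y e) φ) u a b) v =
        wedgePow k (pairForm (c.phaseMat Y hk (φ u).1)ᵀ) (fun s s' => (κ (v s) s' : ℂ)) := by
      simp only [hβ]
      rfl
    have h2 : (Matrix.of fun s s' => (κ (v s) s' : ℂ)).det =
        ((Matrix.of fun s => κ (v s)).det : ℂ) := by
      rw [← Complex.ofRealHom_eq_coe, RingHom.map_det]
      rfl
    rw [h1, hwedge, h2, Matrix.det_transpose, ← im_mul_ofReal_eq_zero_iff hr (z := _ * _ * _)]
    ring_nf
  constructor
  · intro h
    -- The real basis of `ℂᵏ` given by the standard vectors and their multiples by `√-1` turns the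
    -- matrix of the `κ (v s)` into the identity.
    have h1 := (key fun s => M.symm (Pi.single s.1 (![1, Complex.I] s.2))).1 (h _)
    have h2 : (Matrix.of fun s : Fin k × Fin 2 =>
        κ (M.symm (Pi.single s.1 (![1, Complex.I] s.2)))) = 1 := by
      ext ⟨i, a⟩ ⟨j, b⟩
      simp only [Matrix.of_apply, κ, LinearEquiv.apply_symm_apply, rePart, imPart,
        Pi.single_apply, Matrix.one_apply, Prod.mk.injEq]
      by_cases hij : i = j
      · subst hij
        fin_cases a <;> fin_cases b <;> simp
      · fin_cases a <;> fin_cases b <;> simp [hij, Ne.symm hij]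
    rwa [h2, Matrix.det_one, Complex.ofReal_one, mul_one] at h1
  · intro h v
    rw [key, Complex.im_mul_ofReal, h, zero_mul]

end FlatChart

/-! ### Comparison of the two sides over `B(V)` -/

section Main

variable {m : ℕ} {B : Type*} [TopologicalSpace B] [ChartedSpace (Rn m) B]
  {K : ConvexMultivalued m B} {k : ℕ} {V : AffineSection K k} {Y : ∀ p : B, Tan m B p}

theorem exp_neg_I_mul_add (θ : ℝ) (n : ℕ) :
    Complex.exp (-(Complex.I * ((θ + n * (Real.pi / 2) : ℝ) : ℂ))) =
      Complex.exp (-(Complex.I * (θ : ℂ))) * (-Complex.I) ^ n := by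
  rw [← Complex.exp_neg_pi_div_two_mul_I, ← Complex.exp_nat_mul, ← Complex.exp_add]
  congr 1
  push_cast
  ring

/-- For even `n` the factor `(√-1)ⁿ` is `±1`, and a nonzero real factor does not change the
vanishing of an imaginary part. -/
theorem isSpecialLagrangian_add_iff {n : ℕ} (hn : Even n) (θ : ℝ) (L : Set (XB m B)) :
    IsSpecialLagrangian K (θ + n * (Real.pi / 2)) L ↔ IsSpecialLagrangian K θ L := by
  obtain ⟨r, rfl⟩ := hn
  have h1 : (-Complex.I) ^ (r + r) = (((-1) ^ r : ℝ) : ℂ) := by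
    rw [pow_add, ← mul_pow, neg_mul_neg, Complex.I_mul_I]
    push_cast
    rfl
  have h2 : ((-1 : ℝ)) ^ r ≠ 0 := pow_ne_zero _ (by norm_num)
  rw [IsSpecialLagrangian, IsSpecialLagrangian]
  refine and_congr Iff.rfl (forall₅_congr fun e O φ hφ u => forall₂_congr fun hu a => ?_)
  rw [exp_neg_I_mul_add, h1, mul_right_comm, im_mul_ofReal_eq_zero_iff h2]

variable [IsTropicalManifold m B]

theorem FlatChart.exists_isLocalParam_lagrangian (hk : k ≤ m) (hV : V.IsConstant)
    (hY : IsSmoothAlong V Y) {e : TropChart m B} (c : FlatChart V e) {x : Rn m} (hx : x ∈ c.slice) :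
    ∃ (O : Set (Rn m)) (φ : Rn m → Rn m × Rn m), IsLocalParam (xRead e (lagrangian V Y)) O φ ∧
      ∃ u ∈ O, (φ u).1 = x := by
  have h1 : (x, vecCoord Y e x) ∈ xRead e (lagrangian V Y) := by
    rw [c.xRead_lagrangian]
    exact ⟨hx, fun i _ => ⟨0, by simp⟩⟩
  obtain ⟨O, φ, h2, u, hu, h3⟩ := isSubmanifoldX_lagrangian hk hV hY e _ h1
  exact ⟨O, φ, h2, u, hu, by rw [h3]⟩

theorem FlatChart.exists_isHolParam_complexSub (hk : k ≤ m) (hV : V.IsConstant)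
    {e : TropChart m B} (c : FlatChart V e) {x : Rn m} (hx : x ∈ c.slice) :
    ∃ (O : Set (Fin k → ℂ)) (φ : (Fin k → ℂ) → Rn m × Rn m), IsHolParam K (complexSub V) e O φ ∧
      ∃ u ∈ O, (φ u).1 = x := by
  have h1 : (x, 0) ∈ wRead e (complexSub V) := by
    rw [c.wRead_complexSub]
    exact ⟨hx, fun i _ => ⟨0, by simp⟩⟩
  obtain ⟨O, φ, h2, u, hu, h3⟩ := isComplexSubmanifold_complexSub hk hV e _ h1
  exact ⟨O, φ, h2, u, hu, by rw [h3]⟩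

/-- A condition on the points of `B(V)` holds along `L(V,Y)` if and only if it holds on `B(V)`. -/
theorem forall_isLocalParam_lagrangian_iff (hk : k ≤ m) (hV : V.IsConstant)
    (hY : IsSmoothAlong V Y) (c : ∀ e : TropChart m B, FlatChart V e)
    (P : TropChart m B → Rn m → Prop) :
    (∀ (e : TropChart m B) (O : Set (Rn m)) (φ : Rn m → Rn m × Rn m),
      IsLocalParam (xRead e (lagrangian V Y)) O φ → ∀ u ∈ O, P e (φ u).1) ↔
      ∀ e, ∀ x ∈ (c e).slice, P e x := by
  constructor
  · intro h e x hx
    obtain ⟨O, φ, hφ, u, hu, rfl⟩ := (c e).exists_isLocalParam_lagrangian hk hV hY hx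
    exact h e O φ hφ u hu
  · intro h e O φ hφ u hu
    have := hφ.mapsTo hu
    rw [(c e).xRead_lagrangian] at this
    exact h e _ this.1

/-- A condition on the points of `B(V)` holds along `C(V)` if and only if it holds on `B(V)`. -/
theorem forall_isHolParam_complexSub_iff (hk : k ≤ m) (hV : V.IsConstant)
    (c : ∀ e : TropChart m B, FlatChart V e) (P : TropChart m B → Rn m → Prop) :
    (∀ (e : TropChart m B) (O : Set (Fin k → ℂ)) (φ : (Fin k → ℂ) → Rn m × Rn m),
      IsHolParam K (complexSub V) e O φ → ∀ u ∈ O, P e (φ u).1) ↔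
      ∀ e, ∀ x ∈ (c e).slice, P e x := by
  constructor
  · intro h e x hx
    obtain ⟨O, φ, hφ, u, hu, rfl⟩ := (c e).exists_isHolParam_complexSub hk hV hx
    exact h e O φ hφ u hu
  · intro h e O φ hφ u hu
    have := hφ.1.mapsTo hu
    rw [(c e).wRead_complexSub] at this
    exact h e _ this.1

/-- The pointwise criterion involves only the base point, so quantifying over all parametrizations
and parameters amounts to quantifying over `B(V)`. The same descent on the other side makes the two
conditions literally equal. -/
theorem isLagrangian_lagrangian_iff (hk : k ≤ m) (hV : V.IsConstant) (hY : IsSmoothAlong V Y)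
    (c : ∀ e : TropChart m B, FlatChart V e) :
    IsLagrangian K (lagrangian V Y) ↔
      ∀ e, ∀ x ∈ (c e).slice, ((c e).Nk Y hk x)ᵀ = (c e).Nk Y hk x := by
  rw [IsLagrangian, and_iff_right (isSubmanifoldX_lagrangian hk hV hY),
    ← forall_isLocalParam_lagrangian_iff hk hV hY c]
  exact forall₅_congr fun e O φ hφ u => forall_congr' fun hu =>
    (c e).omegaX_eq_zero_iff hk hY hφ hu

theorem isIntegrable_connForm_iff (hk : k ≤ m) (hV : V.IsConstant) (hY : IsSmoothAlong V Y)
    (c : ∀ e : TropChart m B, FlatChart V e) :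
    IsIntegrable k K (complexSub V) (connForm Y) ↔
      ∀ e, ∀ x ∈ (c e).slice, ((c e).Nk Y hk x)ᵀ = (c e).Nk Y hk x := by
  rw [IsIntegrable, ← forall_isHolParam_complexSub_iff hk hV c]
  exact forall₅_congr fun e O φ hφ u => forall_congr' fun hu =>
    (c e).part02_curvature_eq_zero_iff hk hY hφ hu

theorem isLagrangian_iff_isIntegrable (hk : k ≤ m) (hV : V.IsConstant) (hY : IsSmoothAlong V Y) :
    IsLagrangian K (lagrangian V Y) ↔ IsIntegrable k K (complexSub V) (connForm Y) := by
  let c : ∀ e : TropChart m B, FlatChart V e := fun e => (hV.nonempty_flatChart e).some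
  rw [isLagrangian_lagrangian_iff hk hV hY c, isIntegrable_connForm_iff hk hV hY c]

theorem isSpecialLagrangian_iff_isDHYM (hk : k ≤ m) (hV : V.IsConstant) (hY : IsSmoothAlong V Y)
    (θ : ℝ) :
    IsSpecialLagrangian K (θ + ((m : ℝ) - (k : ℝ)) * (Real.pi / 2)) (lagrangian V Y) ↔
      IsDHYM k K θ (complexSub V) (connForm Y) := by
  let c : ∀ e : TropChart m B, FlatChart V e := fun e => (hV.nonempty_flatChart e).some
  rw [IsSpecialLagrangian, IsDHYM, isLagrangian_iff_isIntegrable hk hV hY]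
  refine and_congr Iff.rfl ?_
  trans ∀ e, ∀ x ∈ (c e).slice,
    (Complex.exp (-(Complex.I * (θ : ℂ))) * ((c e).phaseMat Y hk x).det).im = 0
  · rw [← forall_isLocalParam_lagrangian_iff hk hV hY c]
    refine forall₅_congr fun e O φ hφ u => forall_congr' fun hu => ?_
    -- The shift of the angle contributes `(-√-1)^(m-k)`, which cancels the `(√-1)^(m-k)` coming
    -- from the fiber directions of `L(V,Y)`.
    rw [(c e).im_OmegaX_eq_zero_iff hk hY hφ hu, ← Nat.cast_sub hk, exp_neg_I_mul_add, mul_assoc _ _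
      (Complex.I ^ _), ← mul_pow, neg_mul, Complex.I_mul_I, neg_neg, one_pow, mul_one]
  · rw [← forall_isHolParam_complexSub_iff hk hV c]
    exact forall₅_congr fun e O φ hφ u => forall_congr' fun hu =>
      ((c e).im_wedgePow_eq_zero_iff hk hY hφ hu _).symm

end Main

end TropicalMirror

theorem mainTheorem1 {m k : ℕ} (hk : k ≤ m) {B : Type*} [TopologicalSpace B]
    [ChartedSpace (Rn m) B] [IsTropicalManifold m B]
    (K : ConvexMultivalued m B) (V : AffineSection K k) (hV : V.IsConstant)
    (Y : ∀ p : B, Tan m B p) (hY : IsSmoothAlong V Y) :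
    IsSubmanifoldX m (lagrangian V Y) ∧
    IsComplexSubmanifold K k (complexSub V) ∧
    (IsLagrangian K (lagrangian V Y) ↔ IsIntegrable k K (complexSub V) (connForm Y)) ∧
    (∀ θ : ℝ, IsSpecialLagrangian K (θ + ((m : ℝ) - (k : ℝ)) * (Real.pi / 2)) (lagrangian V Y) ↔
      IsDHYM k K θ (complexSub V) (connForm Y)) ∧
    (Even (m - k) → ∀ θ : ℝ, IsSpecialLagrangian K θ (lagrangian V Y) ↔
      IsDHYM k K θ (complexSub V) (connForm Y)) := by
  refine ⟨isSubmanifoldX_lagrangian hk hV hY, isComplexSubmanifold_complexSub hk hV,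
    isLagrangian_iff_isIntegrable hk hV hY, isSpecialLagrangian_iff_isDHYM hk hV hY,
    fun hn θ => ?_⟩
  rw [← isSpecialLagrangian_iff_isDHYM hk hV hY, ← Nat.cast_sub hk, isSpecialLagrangian_add_iff hn]
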